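/- Let $n>m>1$ be integers and let $D\subseteq\{0,\dots,m-1\}\times\{0,\dots,n-1\}$ be non-empty. Let $F\subseteq\mathbb{R}^2$ be the associated Bedford--McMullen carpet, that is, the unique non-empty compact set with $F=\bigcup_{(i,j)\in D}S_{(i,j)}(F)$, where $S_{(i,j)}(x,y)=\left(\frac{x+i}{m},\frac{y+j}{n}\right)$. Let $N=\#D$, let $N_i=\#\{j:(i,j)\in D\}$, let $N_0$ be the number of columns with at least one chosen rectangle, i.e. $N_0=\#\{i: \exists j,\ (i,j)\in D\}$, and let $N_{\max}$ and $N_{\min}$ be the largest and the smallest number of chosen rectangles in a column, over those columns containing at least one chosen rectangle. For bounded $E\subseteq\mathbb{R}^2$ and $r>0$ let $N_r(E)$ be the smallest number of open sets of diameter at most $r$ needed to cover $E$, and let $B(x,R)$ be the closed Euclidean ball. For $\theta\in(0,1)$ the Assouad spectrum $\dim_A^\theta F$ is the infimum of all $\alpha$ for which there is $C>0$ with $N_r(B(x,r^\theta)\cap F)\le C(r^\theta/r)^\alpha$ for all $0<r<1$ and $x\in F$; the lower spectrum $\dim_L^\theta F$ is the supremum of all $\alpha$ for which there is $C>0$ with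 $N_r(B(x,r^\theta)\cap F)\ge C(r^\theta/r)^\alpha$ for all $0<r<1$ and $x\in F$; the Assouad dimension $\dim_A F$ is the infimum of all $\alpha$ for which there is $C>0$ with $N_r(B(x,R)\cap F)\le C(R/r)^\alpha$ for all $0<r<R$ and $x\in F$. The box dimension $\dim_B F$ is the common value, if they agree, of the lower and the upper limit of $\log N_r(F)/(-\log r)$ as $r\to0$. Then $\dim_B F$ exists, $\dim_B F=\frac{\log N_0}{\log m}+\frac{\log(N/N_0)}{\log n}$, and for all $0<\theta\le\log m/\log n$, $$\dim_A^\theta F=\frac{\dim_B F-\theta\left(\frac{\log(N/N_{\max})}{\log m}+\frac{\log N_{\max}}{\log n}\right)}{1-\theta},\qquad \dim_L^\theta F=\frac{\dim_B F-\theta\left(\frac{\log(N/N_{\min})}{\log m}+\frac{\log N_{\min}}{\log n}\right)}{1-\theta},$$ and for all $\log m/\log n\le\theta<1$, $$\dim_A^\theta F=\frac{\log N_0}{\log m}+\frac{\log N_{\max}}{\log n},\qquad \dim_L^\theta F=\frac{\log N_0}{\log m}+\frac{\log N_{\min}}{\log n}.$$ Moreover, $\dim_A F=\frac{\log N_0}{\log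 m}+\frac{\log N_{\max}}{\log n}$. -/

import Mathlib

noncomputable section

namespace Carpet

/-- The Euclidean plane. -/
abbrev Plane : Type := EuclideanSpace ℝ (Fin 2)

/-- `N_r(A)`: the smallest number of open sets of diameter at most `r` needed to cover the
bounded set `A`. -/
def coverNum (r : ℝ) (A : Set Plane) : ℕ :=
  sInf {k : ℕ | ∃ U : Fin k → Set Plane,
    (∀ i, IsOpen (U i)) ∧ (∀ i, ∀ x ∈ U i, ∀ y ∈ U i, dist x y ≤ r) ∧ A ⊆ ⋃ i, U i}

/-- The lower box dimension of a nonempty bounded set. -/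
def lowerBoxDim (F : Set Plane) : ℝ :=
  Filter.liminf (fun r : ℝ => Real.log (coverNum r F) / (-Real.log r)) (nhdsWithin 0 (Set.Ioi 0))

/-- The upper box dimension of a nonempty bounded set. -/
def upperBoxDim (F : Set Plane) : ℝ :=
  Filter.limsup (fun r : ℝ => Real.log (coverNum r F) / (-Real.log r)) (nhdsWithin 0 (Set.Ioi 0))

/-- The box dimension of `F` exists and equals `d`. -/
def HasBoxDim (F : Set Plane) (d : ℝ) : Prop :=
  lowerBoxDim F = d ∧ upperBoxDim F = d

/-- The Assouad dimension `dim_A F`. -/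
def assouadDim (F : Set Plane) : ℝ :=
  sInf {α : ℝ | ∃ C : ℝ, 0 < C ∧ ∀ r R : ℝ, 0 < r → r < R → ∀ x ∈ F,
    (coverNum r (Metric.closedBall x R ∩ F) : ℝ) ≤ C * (R / r) ^ α}

/-- The Assouad spectrum `dim_A^θ F`. -/
def assouadSpectrum (θ : ℝ) (F : Set Plane) : ℝ :=
  sInf {α : ℝ | ∃ C : ℝ, 0 < C ∧ ∀ r : ℝ, 0 < r → r < 1 → ∀ x ∈ F,
    (coverNum r (Metric.closedBall x (r ^ θ) ∩ F) : ℝ) ≤ C * (r ^ θ / r) ^ α}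

/-- The lower spectrum `dim_L^θ F`. -/
def lowerSpectrum (θ : ℝ) (F : Set Plane) : ℝ :=
  sSup {α : ℝ | ∃ C : ℝ, 0 < C ∧ ∀ r : ℝ, 0 < r → r < 1 → ∀ x ∈ F,
    C * (r ^ θ / r) ^ α ≤ (coverNum r (Metric.closedBall x (r ^ θ) ∩ F) : ℝ)}

/-- The map `S_d (x, y) = (x / m + i / m, y / n + j / n)`, `d = (i, j)`, taking the unit square
onto the rectangle of the `m × n` grid in column `i` and row `j`. -/
def gridMap (m n : ℕ) (d : Fin m × Fin n) (p : Plane) : Plane :=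
  !₂[p 0 / m + (d.1 : ℕ) / m, p 1 / n + (d.2 : ℕ) / n]

/-- `F` is the Bedford-McMullen carpet generated by the set `D` of chosen rectangles of the
`m × n` grid: the attractor (that is, the unique nonempty compact invariant set) of the iterated
function system `{S_d}_{d ∈ D}`. -/
def IsCarpet (m n : ℕ) (D : Finset (Fin m × Fin n)) (F : Set Plane) : Prop :=
  F.Nonempty ∧ IsCompact F ∧ F = ⋃ d ∈ D, gridMap m n d '' F

/-- The nonempty columns; their number is `N_0`. -/
def columns {m n : ℕ} (D : Finset (Fin m × Fin n)) : Finset (Fin m) :=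
  D.image Prod.fst

/-- `N_i`: the number of chosen rectangles in column `i`. -/
def columnCount {m n : ℕ} (D : Finset (Fin m × Fin n)) (i : Fin m) : ℕ :=
  (D.filter (fun d => d.1 = i)).card

/-- `N_max`, the largest `N_i` over the nonempty columns. -/
def maxCount {m n : ℕ} (D : Finset (Fin m × Fin n)) (hD : D.Nonempty) : ℕ :=
  (columns D).sup' (hD.image Prod.fst) (columnCount D)

/-- `N_min`, the smallest `N_i` over the nonempty columns. -/
def minCount {m n : ℕ} (D : Finset (Fin m × Fin n)) (hD : D.Nonempty) : ℕ :=
  (columns D).inf' (hD.image Prod.fst) (columnCount D)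

end Carpet

end

noncomputable section

namespace Carpet

/-! The proof counts approximate squares. A cell of level `(k, l)` prescribes the first `k` column
digits and the first `l` row digits of an address; with `m ^ k` and `n ^ l` both comparable to `1 /
R` it is roughly a square of side `R`, and `l ≤ k` because `m < n`. Let `(K, L)` be the level of a
smaller scale `r`. To refine a cell from `(k, l)` to `(K, L)`, a position in `[l, min k L)` already
has its column and chooses one of that column's `N_i` rows, a position in `[k, L)` chooses any of
the `N` rectangles, and a position from `max k L` on chooses one of the `N₀` columns. If all
relevant columns have `M` rectangles, the count is `M ^ (min k L - l) * N ^ (L - k) * N₀ ^ (K - max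
k L)`, with truncated exponents (`card_subcodes`, `prod_weight`).

Up to constants this count is the covering number of a ball of radius `R`: such a ball contains the
cell of its centre and meets boundedly many cells of its own size, and a set of diameter `r` meets
boundedly many cells of level `r` (`IsCarpet.coverNum_le`, `IsCarpet.le_coverNum`). The bounds with
`N_max` from above and `N_min` from below hold at every centre. They are attained at points whose
address is constant, in an extremal column. For the minimum one must exclude richer neighbouring
cells, which is `IsCarpet.column_eq_of_near`.

In logarithmic scales the exponent is homogeneous of degree one, so for `R = r ^ θ` it is linear in
`-log r` and its slope gives the spectra. The phase transition at `θ = log m / log n` is the change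
of sign of `k - L`. The box dimension is the case `k = l = 0`. The Assouad dimension follows from `N
≤ N₀ * N_max` and the spectrum bound at the transition. -/

variable {m n : ℕ}

/-! ### Digit expansions -/

/-- The integer whose base `b` digits, the leading one first, are `a 0, …, a (k - 1)`. -/
def digitIndex {b : ℕ} (a : ℕ → Fin b) : ℕ → ℕ
  | 0 => 0
  | k + 1 => b * digitIndex a k + a k

theorem digitIndex_lt {b : ℕ} (a : ℕ → Fin b) (k : ℕ) : digitIndex a k < b ^ k := by
  induction k with
  | zero => simp [digitIndex]
  | succ k ih =>
    have h := (a k).isLt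
    calc b * digitIndex a k + a k < b * digitIndex a k + b := by omega
      _ = b * (digitIndex a k + 1) := by ring
      _ ≤ b * b ^ k := Nat.mul_le_mul_left _ ih
      _ = b ^ (k + 1) := by ring

theorem digitIndex_congr {b : ℕ} {a a' : ℕ → Fin b} {k : ℕ} (h : ∀ j < k, a j = a' j) :
    digitIndex a k = digitIndex a' k := by
  induction k with
  | zero => rfl
  | succ k ih =>
    simp only [digitIndex]
    rw [ih fun j hj => h j (by omega), h k (by omega)]

theorem digitIndex_inj {b : ℕ} {a a' : ℕ → Fin b} {k : ℕ} (h : digitIndex a k = digitIndex a' k) :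
    ∀ j < k, a j = a' j := by
  induction k with
  | zero => intro j hj; omega
  | succ k ih =>
    simp only [digitIndex] at h
    have hb : 0 < b := (a 0).pos
    have h1 := congrArg (· / b) h
    have h2 := congrArg (· % b) h
    simp only [Nat.mul_add_div hb, Nat.div_eq_of_lt (a k).isLt, Nat.div_eq_of_lt (a' k).isLt,
      add_zero] at h1
    simp only [Nat.mul_add_mod, Nat.mod_eq_of_lt (a k).isLt, Nat.mod_eq_of_lt (a' k).isLt] at h2
    intro j hj
    rcases Nat.lt_succ_iff_lt_or_eq.1 hj with hj | rfl
    · exact ih h1 j hj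
    · exact Fin.ext h2

/-! ### Codes and the number of their refinements -/

/-- The part of a digit in position `j` that remains when only the first `k` columns and the
first `l` rows of a word are kept. -/
def mask (k l j : ℕ) (d : Fin m × Fin n) : Option (Fin m) × Option (Fin n) :=
  (if j < k then some d.1 else none, if j < l then some d.2 else none)

/-- The first `k` columns and the first `l` rows of a word. -/
def code (k l : ℕ) {K : ℕ} (w : Fin K → Fin m × Fin n) :
    Fin K → Option (Fin m) × Option (Fin n) :=
  fun j => mask k l j (w j)

/-- The words of length `K` over the alphabet `D`. -/
def words (D : Finset (Fin m × Fin n)) (K : ℕ) : Finset (Fin K → Fin m × Fin n) :=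
  Fintype.piFinset fun _ => D

theorem mem_words {D : Finset (Fin m × Fin n)} {K : ℕ} {w : Fin K → Fin m × Fin n} :
    w ∈ words D K ↔ ∀ j, w j ∈ D := by
  simp [words]

/-- The codes of level `(K, L)` of the words that agree with `w₀` at level `(k, l)`. -/
def subcodes (D : Finset (Fin m × Fin n)) (k l L : ℕ) {K : ℕ} (w₀ : Fin K → Fin m × Fin n) :
    Finset (Fin K → Option (Fin m) × Option (Fin n)) :=
  ((words D K).filter fun w => code k l w = code k l w₀).image (code K L)

/-- Both agreement with `w₀` and the passage to codes act position by position, so the set of codes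
is a product of images and its cardinality a product. -/
theorem card_subcodes (D : Finset (Fin m × Fin n)) (k l L : ℕ) {K : ℕ}
    (w₀ : Fin K → Fin m × Fin n) :
    (subcodes D k l L w₀).card =
      ∏ j : Fin K, ((D.filter fun d => mask k l j d = mask k l j (w₀ j)).image
        (mask K L j)).card := by
  have h : (words D K).filter (fun w => code k l w = code k l w₀) =
      Fintype.piFinset fun j : Fin K => D.filter fun d => mask k l j d = mask k l j (w₀ j) := by
    ext w
    simp [words, code, funext_iff, forall_and]
  have h2 := Fintype.piFinset_image
    (fun j : Fin K => (mask K L j : Fin m × Fin n → _))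
    (fun j : Fin K => D.filter fun d => mask k l j d = mask k l j (w₀ j))
  rw [subcodes, h, ← Fintype.card_piFinset, h2]
  rfl

/-- The number of ways to refine position `j` from level `(k, l)` to level `(K, L)`, in a column
with `M` chosen rectangles. -/
def weight (D : Finset (Fin m × Fin n)) (M k l L j : ℕ) : ℕ :=
  if j < l then 1 else if j < k then (if j < L then M else 1) else
    if j < L then D.card else (columns D).card

/-- Below `l` the whole digit is known, since `l ≤ k`. Between `l` and `k` only the column is known,
and the fine code sees the rows of that column if `j < L` and nothing new otherwise. From `k` on the
digit is free, and the fine code sees all of it if `j < L` and only its column otherwise. -/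
theorem card_image_mask {D : Finset (Fin m × Fin n)} {k l K L j : ℕ} (hj : j < K)
    (hlk : l ≤ k) {d₀ : Fin m × Fin n} (hd : d₀ ∈ D) :
    ((D.filter fun d => mask k l j d = mask k l j d₀).image (mask K L j)).card =
      weight D (columnCount D d₀.1) k l L j := by
  unfold weight
  have hinj : j < L → Function.Injective (mask K L j : Fin m × Fin n → _) := by
    intro hL a b h
    simpa [mask, hj, hL, Prod.ext_iff] using h
  split_ifs with h1 h2 h3 h4
  · have h2 : j < k := by omega
    have : (D.filter fun d => mask k l j d = mask k l j d₀) = {d₀} := by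
      ext d
      simp only [mask, h1, h2, if_true, Prod.ext_iff, Option.some.injEq, Finset.mem_filter,
        Finset.mem_singleton]
      constructor
      · exact fun h => h.2
      · intro h
        obtain rfl : d = d₀ := Prod.ext h.1 h.2
        exact ⟨hd, h⟩
    rw [this]; simp
  · rw [Finset.card_image_of_injective _ (hinj h3)]
    simp [mask, h1, h2, columnCount]
  · rw [Finset.card_eq_one]
    refine ⟨mask K L j d₀, ?_⟩
    ext c
    simp only [mask, h1, h2, h3, hj, if_true, if_false, Prod.ext_iff, Option.some.injEq,
      Finset.mem_image, Finset.mem_filter, Finset.mem_singleton]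
    constructor
    · rintro ⟨a, ⟨_, ha⟩, hc⟩
      rw [← ha.1]; exact ⟨hc.1.symm, hc.2.symm⟩
    · intro h
      exact ⟨d₀, ⟨hd, by simp⟩, h.1.symm, h.2.symm⟩
  · rw [Finset.card_image_of_injective _ (hinj h4)]
    simp [mask, h1, h2]
  · have : (D.filter fun d => mask k l j d = mask k l j d₀) = D := by
      simp [mask, h1, h2]
    rw [this, columns]
    have h5 : (mask K L j : Fin m × Fin n → _) =
        (fun i : Fin m => ((some i, none) : Option (Fin m) × Option (Fin n))) ∘ Prod.fst := by
      funext d; simp [mask, hj, h4]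
    rw [h5, ← Finset.image_image, Finset.card_image_of_injective]
    intro a b h
    simpa using h

theorem prod_ite_Ico (M a b K : ℕ) (hb : b ≤ K) :
    ∏ j ∈ Finset.range K, (if a ≤ j ∧ j < b then M else 1) = M ^ (b - a) := by
  rw [Finset.prod_ite, Finset.prod_const, Finset.prod_const, one_pow, mul_one]
  have : (Finset.range K).filter (fun j => a ≤ j ∧ j < b) = Finset.Ico a b := by
    ext j; simp; omega
  rw [this, Nat.card_Ico]

/-- The weight is constant on consecutive intervals of positions. Truncated subtraction covers both
orders of `k` and `L`: for `L < k` the factor with `D.card` disappears and the positions in `[L, k)`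
contribute `1`. -/
theorem prod_weight (D : Finset (Fin m × Fin n)) (M : ℕ) {k l K L : ℕ} (hlk : l ≤ k) (hlL : l ≤ L)
    (hk : k ≤ K) (hL : L ≤ K) :
    ∏ j : Fin K, weight D M k l L j =
      M ^ (min k L - l) * D.card ^ (L - k) * (columns D).card ^ (K - max k L) := by
  rw [Fin.prod_univ_eq_prod_range fun j => weight D M k l L j,
    ← prod_ite_Ico M l (min k L) K (by omega), ← prod_ite_Ico _ k L K hL,
    ← prod_ite_Ico _ (max k L) K K le_rfl, ← Finset.prod_mul_distrib, ← Finset.prod_mul_distrib]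
  refine Finset.prod_congr rfl fun j hj => ?_
  have := Finset.mem_range.1 hj
  unfold weight
  split_ifs <;> omega

theorem weight_mono (D : Finset (Fin m × Fin n)) {M M' : ℕ} (h : M ≤ M') (k l L j : ℕ) :
    weight D M k l L j ≤ weight D M' k l L j := by
  unfold weight
  split_ifs <;> simp [h]

theorem weight_congr (D : Finset (Fin m × Fin n)) (M M' k l L j : ℕ) (h : k ≤ j) :
    weight D M k l L j = weight D M' k l L j := by
  simp [weight, not_lt.2 h]

section
variable {D : Finset (Fin m × Fin n)} {k l K L M : ℕ} {w₀ : Fin K → Fin m × Fin n}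

/-- The weight depends on the column only at positions below `k`, so only the first `k` columns of
`w₀` have to be controlled. -/
theorem card_subcodes_le (hlk : l ≤ k) (hlL : l ≤ L) (hk : k ≤ K) (hL : L ≤ K)
    (hw : w₀ ∈ words D K) (hM : ∀ j : Fin K, (j : ℕ) < k → columnCount D (w₀ j).1 ≤ M) :
    (subcodes D k l L w₀).card ≤
      M ^ (min k L - l) * D.card ^ (L - k) * (columns D).card ^ (K - max k L) := by
  rw [card_subcodes, ← prod_weight D M hlk hlL hk hL]
  refine Finset.prod_le_prod' fun j _ => ?_
  rw [card_image_mask j.isLt hlk (mem_words.1 hw j)]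
  rcases lt_or_ge (j : ℕ) k with hj | hj
  · exact weight_mono D (hM j hj) ..
  · exact (weight_congr D _ _ k l L j hj).le

theorem le_card_subcodes (hlk : l ≤ k) (hlL : l ≤ L) (hk : k ≤ K) (hL : L ≤ K)
    (hw : w₀ ∈ words D K) (hM : ∀ j : Fin K, (j : ℕ) < k → M ≤ columnCount D (w₀ j).1) :
    M ^ (min k L - l) * D.card ^ (L - k) * (columns D).card ^ (K - max k L) ≤
      (subcodes D k l L w₀).card := by
  rw [card_subcodes, ← prod_weight D M hlk hlL hk hL]
  refine Finset.prod_le_prod' fun j _ => ?_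
  rw [card_image_mask j.isLt hlk (mem_words.1 hw j)]
  rcases lt_or_ge (j : ℕ) k with hj | hj
  · exact weight_mono D (hM j hj) ..
  · exact (weight_congr D _ _ k l L j hj).le

end

/-! ### Cells of the carpet and addresses of its points -/

/-- The composition of the grid maps of the first `k` digits of `ω`. -/
def cellMap (ω : ℕ → Fin m × Fin n) (k : ℕ) (p : Plane) : Plane :=
  !₂[((digitIndex (fun j => (ω j).1) k : ℕ) + p 0) / (m : ℝ) ^ k,
    ((digitIndex (fun j => (ω j).2) k : ℕ) + p 1) / (n : ℝ) ^ k]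

theorem cellMap_zero (ω : ℕ → Fin m × Fin n) (p : Plane) : cellMap ω 0 p = p := by
  ext i
  fin_cases i <;> simp [cellMap, digitIndex]

theorem cellMap_succ (ω : ℕ → Fin m × Fin n) (k : ℕ) (p : Plane) :
    cellMap ω (k + 1) p = cellMap ω k (gridMap m n (ω k) p) := by
  have hm : (m : ℝ) ≠ 0 := by exact_mod_cast (ω 0).1.pos.ne'
  have hn : (n : ℝ) ≠ 0 := by exact_mod_cast (ω 0).2.pos.ne'
  ext i
  fin_cases i
  · simp [cellMap, gridMap, digitIndex]; field_simp; ring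
  · simp [cellMap, gridMap, digitIndex]; field_simp; ring

theorem cellMap_congr {ω ω' : ℕ → Fin m × Fin n} {k : ℕ} (h : ∀ j < k, ω j = ω' j) (p : Plane) :
    cellMap ω k p = cellMap ω' k p := by
  have h1 : digitIndex (fun j => (ω j).1) k = digitIndex (fun j => (ω' j).1) k :=
    digitIndex_congr fun j hj => by rw [h j hj]
  have h2 : digitIndex (fun j => (ω j).2) k = digitIndex (fun j => (ω' j).2) k :=
    digitIndex_congr fun j hj => by rw [h j hj]
  simp only [cellMap, h1, h2]

/-- A code amounts to the pair of integers locating its cell in the grid. Counting codes near a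
point thus becomes counting lattice points in a box. -/
theorem code_eq_iff {K k l : ℕ} (hk : k ≤ K) (hl : l ≤ K) (ω ω' : ℕ → Fin m × Fin n) :
    code k l (fun j : Fin K => ω j) = code k l (fun j : Fin K => ω' j) ↔
      digitIndex (fun j => (ω j).1) k = digitIndex (fun j => (ω' j).1) k ∧
      digitIndex (fun j => (ω j).2) l = digitIndex (fun j => (ω' j).2) l := by
  constructor
  · intro h
    refine ⟨digitIndex_congr fun j hj => ?_, digitIndex_congr fun j hj => ?_⟩
    · have := congrArg Prod.fst (congrFun h ⟨j, by omega⟩)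
      simpa [code, mask, hj] using this
    · have := congrArg Prod.snd (congrFun h ⟨j, by omega⟩)
      simpa [code, mask, hj] using this
  · rintro ⟨h1, h2⟩
    funext j
    refine Prod.ext ?_ ?_
    · simp only [code, mask]
      split_ifs with hj
      · rw [digitIndex_inj h1 j hj]
      · rfl
    · simp only [code, mask]
      split_ifs with hj
      · rw [digitIndex_inj h2 j hj]
      · rfl

theorem exists_sequence {D : Finset (Fin m × Fin n)} (hD : D.Nonempty) {K : ℕ}
    {w : Fin K → Fin m × Fin n} (hw : w ∈ words D K) :
    ∃ ω : ℕ → Fin m × Fin n, (∀ j, ω j ∈ D) ∧ (fun j : Fin K => ω j) = w := by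
  obtain ⟨d₀, hd₀⟩ := hD
  refine ⟨fun j => if h : j < K then w ⟨j, h⟩ else d₀, fun j => ?_, ?_⟩
  · dsimp only
    split_ifs
    · exact mem_words.1 hw _
    · exact hd₀
  · funext j; simp

theorem restrict_mem_words {D : Finset (Fin m × Fin n)} {ω : ℕ → Fin m × Fin n}
    (hω : ∀ j, ω j ∈ D) (K : ℕ) : (fun j : Fin K => ω j) ∈ words D K :=
  mem_words.2 fun j => hω j

theorem gridMap_zero (d : Fin m × Fin n) (p : Plane) :
    gridMap m n d p 0 = p 0 / m + (d.1 : ℕ) / m := rfl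

theorem gridMap_one (d : Fin m × Fin n) (p : Plane) :
    gridMap m n d p 1 = p 1 / n + (d.2 : ℕ) / n := rfl

section
variable {D : Finset (Fin m × Fin n)} {F : Set Plane}

theorem IsCarpet.exists_eq_gridMap (hF : IsCarpet m n D F) {x : Plane} (hx : x ∈ F) :
    ∃ d ∈ D, ∃ y ∈ F, x = gridMap m n d y := by
  rw [hF.2.2] at hx
  simp only [Set.mem_iUnion] at hx
  obtain ⟨d, hd, y, hy, rfl⟩ := hx
  exact ⟨d, hd, y, hy, rfl⟩

theorem IsCarpet.gridMap_mem (hF : IsCarpet m n D F) {d : Fin m × Fin n} (hd : d ∈ D) {y : Plane}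
    (hy : y ∈ F) : gridMap m n d y ∈ F := by
  rw [hF.2.2]
  exact Set.mem_biUnion hd ⟨y, hy, rfl⟩

/-- A compact set each of whose points has a coordinate of the form `(t + a) / b`, with `t` the
same coordinate of another point and `0 ≤ a < b` a digit, has that coordinate in `[0, 1]`. -/
theorem coordinate_mem_Icc {F : Set Plane} (hc : IsCompact F) (i : Fin 2) {b : ℕ}
    (hb : 1 < b) (h : ∀ x ∈ F, ∃ y ∈ F, ∃ a : ℕ, a < b ∧ x i = y i / b + a / b) :
    ∀ x ∈ F, x i ∈ Set.Icc (0 : ℝ) 1 := by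
  intro x hx
  have hcont : ContinuousOn (fun y : Plane => y i) F := by fun_prop
  have hb' : (1 : ℝ) < b := by exact_mod_cast hb
  have hb0 : (0 : ℝ) < b := by linarith
  constructor
  -- At a minimizer `z` the relation gives `b * z i = y i + a ≥ z i`, hence `z i ≥ 0`. The upper
  -- bound is the same argument at a maximizer, with `a ≤ b - 1`.
  · obtain ⟨z, hz, hzmin⟩ := hc.exists_isMinOn ⟨x, hx⟩ hcont
    obtain ⟨y, hy, a, ha, hza⟩ := h z hz
    have h1 : z i ≤ y i := hzmin hy
    have h2 : z i ≤ x i := hzmin hx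
    have h3 : z i * b = y i + a := by rw [hza]; field_simp
    have h4 : (0 : ℝ) ≤ a := a.cast_nonneg
    nlinarith
  · obtain ⟨z, hz, hzmax⟩ := hc.exists_isMaxOn ⟨x, hx⟩ hcont
    obtain ⟨y, hy, a, ha, hza⟩ := h z hz
    have h1 : y i ≤ z i := hzmax hy
    have h2 : x i ≤ z i := hzmax hx
    have h3 : z i * b = y i + a := by rw [hza]; field_simp
    have h4 : (a : ℝ) + 1 ≤ b := by exact_mod_cast ha
    nlinarith

theorem IsCarpet.mem_Icc (hm : 1 < m) (hn : 1 < n) (hF : IsCarpet m n D F) {x : Plane}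
    (hx : x ∈ F) : x 0 ∈ Set.Icc (0 : ℝ) 1 ∧ x 1 ∈ Set.Icc (0 : ℝ) 1 := by
  refine ⟨coordinate_mem_Icc hF.2.1 0 hm (fun x hx => ?_) x hx,
    coordinate_mem_Icc hF.2.1 1 hn (fun x hx => ?_) x hx⟩
  · obtain ⟨d, -, y, hy, rfl⟩ := hF.exists_eq_gridMap hx
    exact ⟨y, hy, d.1, d.1.isLt, gridMap_zero d y⟩
  · obtain ⟨d, -, y, hy, rfl⟩ := hF.exists_eq_gridMap hx
    exact ⟨y, hy, d.2, d.2.isLt, gridMap_one d y⟩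

/-- Only finitely many digits are ever needed, so a point is written as a `K`-fold image of a point
of `F` instead of a limit; the digits of `ω` from `K` on are arbitrary elements of `D`. -/
theorem IsCarpet.exists_address (hF : IsCarpet m n D F) (hD : D.Nonempty) {x : Plane}
    (hx : x ∈ F) (K : ℕ) :
    ∃ ω : ℕ → Fin m × Fin n, (∀ j, ω j ∈ D) ∧ ∃ p ∈ F, x = cellMap ω K p := by
  induction K with
  | zero =>
    obtain ⟨d, hd⟩ := hD
    exact ⟨fun _ => d, fun _ => hd, x, hx, (cellMap_zero _ x).symm⟩
  | succ K ih =>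
    obtain ⟨ω, hω, p, hp, rfl⟩ := ih
    obtain ⟨d, hd, q, hq, rfl⟩ := hF.exists_eq_gridMap hp
    refine ⟨Function.update ω K d, fun j => ?_, q, hq, ?_⟩
    · rcases eq_or_ne j K with rfl | hj
      · simpa using hd
      · simpa [hj] using hω j
    · rw [cellMap_succ, Function.update_self]
      exact cellMap_congr (fun j hj => by simp [hj.ne]) _

/-- The digits from `k` to `K - 1` act innermost, so they can be absorbed into the point; this is
the nesting of cells. -/
theorem IsCarpet.exists_cellMap_eq (hF : IsCarpet m n D F) {ω : ℕ → Fin m × Fin n}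
    (hω : ∀ j, ω j ∈ D) {k K : ℕ} (hk : k ≤ K) {p : Plane} (hp : p ∈ F) :
    ∃ q ∈ F, cellMap ω K p = cellMap ω k q := by
  induction K, hk using Nat.le_induction generalizing p with
  | base => exact ⟨p, hp, rfl⟩
  | succ K _ ih =>
    obtain ⟨q, hq, h⟩ := ih (hF.gridMap_mem (hω K) hp)
    exact ⟨q, hq, by rw [cellMap_succ, h]⟩

theorem IsCarpet.cellMap_mem (hF : IsCarpet m n D F) {ω : ℕ → Fin m × Fin n}
    (hω : ∀ j, ω j ∈ D) (K : ℕ) {p : Plane} (hp : p ∈ F) : cellMap ω K p ∈ F := by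
  obtain ⟨q, hq, h⟩ := hF.exists_cellMap_eq hω (Nat.zero_le K) hp
  rwa [h, cellMap_zero]

theorem IsCarpet.column_bounds (hm : 1 < m) (hn : 1 < n) (hF : IsCarpet m n D F)
    {ω : ℕ → Fin m × Fin n} (hω : ∀ j, ω j ∈ D) {k K : ℕ} (hk : k ≤ K) {p : Plane} (hp : p ∈ F) :
    (digitIndex (fun j => (ω j).1) k : ℝ) ≤ m ^ k * cellMap ω K p 0 ∧
      m ^ k * cellMap ω K p 0 ≤ digitIndex (fun j => (ω j).1) k + 1 := by
  obtain ⟨q, hq, h⟩ := hF.exists_cellMap_eq hω hk hp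
  have hm0 : (0 : ℝ) < (m : ℝ) ^ k := by positivity
  have h2 : (m : ℝ) ^ k * cellMap ω K p 0 = digitIndex (fun j => (ω j).1) k + q 0 := by
    rw [h]; simp only [cellMap]; simp; field_simp
  have := (hF.mem_Icc hm hn hq).1
  rw [h2]
  exact ⟨by linarith [this.1], by linarith [this.2]⟩

theorem IsCarpet.row_bounds (hm : 1 < m) (hn : 1 < n) (hF : IsCarpet m n D F)
    {ω : ℕ → Fin m × Fin n} (hω : ∀ j, ω j ∈ D) {k K : ℕ} (hk : k ≤ K) {p : Plane} (hp : p ∈ F) :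
    (digitIndex (fun j => (ω j).2) k : ℝ) ≤ n ^ k * cellMap ω K p 1 ∧
      n ^ k * cellMap ω K p 1 ≤ digitIndex (fun j => (ω j).2) k + 1 := by
  obtain ⟨q, hq, h⟩ := hF.exists_cellMap_eq hω hk hp
  have hm0 : (0 : ℝ) < (n : ℝ) ^ k := by positivity
  have h2 : (n : ℝ) ^ k * cellMap ω K p 1 = digitIndex (fun j => (ω j).2) k + q 1 := by
    rw [h]; simp only [cellMap]; simp; field_simp
  have := (hF.mem_Icc hm hn hq).2
  rw [h2]
  exact ⟨by linarith [this.1], by linarith [this.2]⟩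

end

/-! ### Distances between points and cells -/

theorem abs_coord_sub_le_dist (x y : Plane) (i : Fin 2) : |x i - y i| ≤ dist x y := by
  rw [EuclideanSpace.dist_eq, ← Real.dist_eq, ← Real.sqrt_sq (dist_nonneg (x := x i) (y := y i))]
  exact Real.sqrt_le_sqrt
    (Finset.single_le_sum (f := fun i => dist (x i) (y i) ^ 2) (fun _ _ => sq_nonneg _)
      (Finset.mem_univ i))

theorem dist_le_add_abs (x y : Plane) : dist x y ≤ |x 0 - y 0| + |x 1 - y 1| := by
  rw [EuclideanSpace.dist_eq, Real.sqrt_le_left (by positivity), Fin.sum_univ_two, Real.dist_eq,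
    Real.dist_eq]
  nlinarith [abs_nonneg (x 0 - y 0), abs_nonneg (x 1 - y 1)]

theorem card_Icc_ceil_floor_le {a b : ℝ} (h : a ≤ b) :
    ((Finset.Icc ⌈a⌉ ⌊b⌋).card : ℝ) ≤ b - a + 1 := by
  rw [Int.card_Icc]
  rcases le_total 0 (⌊b⌋ + 1 - ⌈a⌉) with h0 | h0
  · have h1 : (((⌊b⌋ + 1 - ⌈a⌉).toNat : ℤ) : ℝ) = ((⌊b⌋ + 1 - ⌈a⌉ : ℤ) : ℝ) := by
      rw [Int.toNat_of_nonneg h0]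
    push_cast at h1
    rw [h1]
    linarith [Int.floor_le b, Int.le_ceil a]
  · rw [Int.toNat_of_nonpos h0]
    push_cast
    linarith

section
variable {D : Finset (Fin m × Fin n)} {F : Set Plane}

/-- A ball meets few cells of its own size. -/
theorem IsCarpet.card_codes_near_le (hm : 1 < m) (hn : 1 < n) (hF : IsCarpet m n D F) {k l K : ℕ}
    (hk : k ≤ K) (hl : l ≤ K) (c : Plane) {ρ : ℝ} (hρ : 0 ≤ ρ)
    (T : Finset (Fin K → Option (Fin m) × Option (Fin n)))
    (hT : ∀ t ∈ T, ∃ ω : ℕ → Fin m × Fin n, (∀ j, ω j ∈ D) ∧ code k l (fun j : Fin K => ω j) = t ∧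
      ∃ p ∈ F, dist (cellMap ω K p) c ≤ ρ) :
    (T.card : ℝ) ≤ (2 * ρ * m ^ k + 2) * (2 * ρ * n ^ l + 2) := by
  have : Nonempty (ℕ → Fin m × Fin n) := ⟨fun _ => (⟨0, by omega⟩, ⟨0, by omega⟩)⟩
  choose! ω hω hcode p hp hd using hT
  -- The index of a cell lies within `1` below the rescaled coordinate of any of its points, which
  -- explains the `- 1` at the lower endpoints.
  set a : ℝ := m ^ k * (c 0 - ρ) - 1
  set b : ℝ := m ^ k * (c 0 + ρ)
  set a' : ℝ := n ^ l * (c 1 - ρ) - 1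
  set b' : ℝ := n ^ l * (c 1 + ρ)
  have hmk : (0 : ℝ) < (m : ℝ) ^ k := by positivity
  have hnl : (0 : ℝ) < (n : ℝ) ^ l := by positivity
  let f : (Fin K → Option (Fin m) × Option (Fin n)) → ℤ × ℤ := fun t =>
    ((digitIndex (fun j => (ω t j).1) k : ℕ), (digitIndex (fun j => (ω t j).2) l : ℕ))
  have hmaps : ∀ t ∈ T, f t ∈ Finset.Icc ⌈a⌉ ⌊b⌋ ×ˢ Finset.Icc ⌈a'⌉ ⌊b'⌋ := by
    intro t ht
    obtain ⟨h1, h2⟩ := hF.column_bounds hm hn (hω t ht) hk (hp t ht)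
    obtain ⟨h3, h4⟩ := hF.row_bounds hm hn (hω t ht) hl (hp t ht)
    obtain ⟨h5, h6⟩ := abs_le.1 ((abs_coord_sub_le_dist _ _ 0).trans (hd t ht))
    obtain ⟨h7, h8⟩ := abs_le.1 ((abs_coord_sub_le_dist _ _ 1).trans (hd t ht))
    simp only [f, Finset.mem_product, Finset.mem_Icc, Int.ceil_le, Int.le_floor, Int.cast_natCast,
      a, b, a', b']
    refine ⟨⟨?_, ?_⟩, ?_, ?_⟩ <;> nlinarith
  have hinj : Set.InjOn f T := by
    intro t ht t' ht' h
    simp only [f, Prod.ext_iff, Nat.cast_inj] at h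
    rw [← hcode t ht, ← hcode t' ht', code_eq_iff hk hl]
    exact h
  have hcard := Finset.card_le_card_of_injOn f hmaps hinj
  rw [Finset.card_product] at hcard
  have hab : a ≤ b := by simp only [a, b]; nlinarith
  have hab' : a' ≤ b' := by simp only [a', b']; nlinarith
  calc (T.card : ℝ) ≤ ((Finset.Icc ⌈a⌉ ⌊b⌋).card : ℝ) * (Finset.Icc ⌈a'⌉ ⌊b'⌋).card := by
        exact_mod_cast hcard
    _ ≤ (b - a + 1) * (b' - a' + 1) :=
        mul_le_mul (card_Icc_ceil_floor_le hab) (card_Icc_ceil_floor_le hab') (by positivity)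
          (by linarith)
    _ = (2 * ρ * m ^ k + 2) * (2 * ρ * n ^ l + 2) := by simp only [a, b, a', b']; ring

/-- Points in the same cell are close. -/
theorem IsCarpet.dist_cellMap_le (hm : 1 < m) (hn : 1 < n) (hF : IsCarpet m n D F) {k l K : ℕ}
    (hk : k ≤ K) (hl : l ≤ K) {ω ω' : ℕ → Fin m × Fin n} (hω : ∀ j, ω j ∈ D) (hω' : ∀ j, ω' j ∈ D)
    (h : code k l (fun j : Fin K => ω j) = code k l (fun j : Fin K => ω' j)) {p p' : Plane}
    (hp : p ∈ F) (hp' : p' ∈ F) :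
    dist (cellMap ω K p) (cellMap ω' K p') ≤ 1 / m ^ k + 1 / n ^ l := by
  rw [code_eq_iff hk hl] at h
  obtain ⟨h1, h2⟩ := hF.column_bounds hm hn hω hk hp
  obtain ⟨h3, h4⟩ := hF.row_bounds hm hn hω hl hp
  obtain ⟨h5, h6⟩ := hF.column_bounds hm hn hω' hk hp'
  obtain ⟨h7, h8⟩ := hF.row_bounds hm hn hω' hl hp'
  rw [← h.1] at h5 h6
  rw [← h.2] at h7 h8
  have hmk : (0 : ℝ) < (m : ℝ) ^ k := by positivity
  have hnl : (0 : ℝ) < (n : ℝ) ^ l := by positivity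
  refine (dist_le_add_abs _ _).trans (add_le_add ?_ ?_)
  · rw [le_div_iff₀ hmk, ← abs_of_pos hmk, ← abs_mul, abs_le]
    constructor <;> linarith
  · rw [le_div_iff₀ hnl, ← abs_of_pos hnl, ← abs_mul, abs_le]
    constructor <;> linarith

end

/-! ### Covering numbers compared with numbers of codes -/

theorem coverNum_le_card {ι : Type*} {r : ℝ} {A : Set Plane} (T : Finset ι) (U : ι → Set Plane)
    (hU : ∀ t ∈ T, IsOpen (U t)) (hd : ∀ t ∈ T, ∀ x ∈ U t, ∀ y ∈ U t, dist x y ≤ r)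
    (hA : ∀ x ∈ A, ∃ t ∈ T, x ∈ U t) : coverNum r A ≤ T.card := by
  refine Nat.sInf_le ⟨fun i => U (T.equivFin.symm i), fun i => hU _ (T.equivFin.symm i).2,
    fun i => hd _ (T.equivFin.symm i).2, fun x hx => ?_⟩
  obtain ⟨t, ht, hxt⟩ := hA x hx
  exact Set.mem_iUnion.2 ⟨T.equivFin ⟨t, ht⟩, by simpa using hxt⟩

/-- Compactness makes the set of admissible cardinalities non-empty, so the infimum in `coverNum` is
attained and is not the default value `0`. -/
theorem exists_cover {r : ℝ} (hr : 0 < r) {A F : Set Plane} (hF : IsCompact F) (hA : A ⊆ F) :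
    ∃ U : Fin (coverNum r A) → Set Plane, (∀ i, IsOpen (U i)) ∧
      (∀ i, ∀ x ∈ U i, ∀ y ∈ U i, dist x y ≤ r) ∧ A ⊆ ⋃ i, U i := by
  refine Nat.sInf_mem (s := {k : ℕ | ∃ U : Fin k → Set Plane,
    (∀ i, IsOpen (U i)) ∧ (∀ i, ∀ x ∈ U i, ∀ y ∈ U i, dist x y ≤ r) ∧ A ⊆ ⋃ i, U i}) ?_
  obtain ⟨t, -, ht, hcov⟩ := hF.finite_cover_balls (half_pos hr)
  refine ⟨ht.toFinset.card, fun i => Metric.ball (ht.toFinset.equivFin.symm i : Plane) (r / 2),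
    fun i => Metric.isOpen_ball, fun i x hx y hy => ?_, fun x hx => ?_⟩
  · have h1 := Metric.mem_ball.1 hx
    have h2 := Metric.mem_ball'.1 hy
    exact (dist_triangle _ _ _).trans (by linarith)
  · obtain ⟨y, hy, hxy⟩ := Set.mem_iUnion₂.1 (hcov (hA hx))
    exact Set.mem_iUnion.2 ⟨ht.toFinset.equivFin ⟨y, by simpa using hy⟩, by simpa using hxy⟩

section
variable {D : Finset (Fin m × Fin n)} {F : Set Plane}

/-- The points of `A` have boundedly many codes of level `(k, l)`, each code has the counted number
of refinements, and one ball of radius `r / 2` covers each refined cell. -/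
theorem IsCarpet.coverNum_le (hm : 1 < m) (hn : 1 < n) (hD : D.Nonempty) (hF : IsCarpet m n D F)
    {k l K L M : ℕ} (hlk : l ≤ k) (hlL : l ≤ L) (hk : k ≤ K) (hL : L ≤ K) {r ρ : ℝ}
    (hρ : 0 ≤ ρ) (hr : 0 < r) (hK : 1 / (m : ℝ) ^ K ≤ r / 8) (hLr : 1 / (n : ℝ) ^ L ≤ r / 8)
    {A : Set Plane} (hA : A ⊆ F) (c : Plane) (hc : ∀ x ∈ A, dist x c ≤ ρ)
    (hM : ∀ ω : ℕ → Fin m × Fin n, (∀ j, ω j ∈ D) → ∀ p ∈ F, cellMap ω K p ∈ A →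
      ∀ j < k, columnCount D (ω j).1 ≤ M) :
    (coverNum r A : ℝ) ≤ (2 * ρ * m ^ k + 2) * (2 * ρ * n ^ l + 2) *
      ((M ^ (min k L - l) * D.card ^ (L - k) * (columns D).card ^ (K - max k L) : ℕ) : ℝ) := by
  classical
  set T : Finset (Fin K → Fin m × Fin n) := (words D K).filter fun w =>
    ∃ ω : ℕ → Fin m × Fin n, (∀ j, ω j ∈ D) ∧ (fun j : Fin K => ω j) = w ∧
      ∃ p ∈ F, cellMap ω K p ∈ A with hT
  have hTmem : ∀ w ∈ T, ∃ ω : ℕ → Fin m × Fin n, (∀ j, ω j ∈ D) ∧ (fun j : Fin K => ω j) = w ∧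
      ∃ p ∈ F, cellMap ω K p ∈ A := fun w hw => (Finset.mem_filter.1 hw).2
  have h0 : ((T.image (code k l)).card : ℝ) ≤ (2 * ρ * m ^ k + 2) * (2 * ρ * n ^ l + 2) := by
    refine hF.card_codes_near_le hm hn hk (hlL.trans hL) c hρ _ fun t ht => ?_
    obtain ⟨w, hw, rfl⟩ := Finset.mem_image.1 ht
    obtain ⟨ω, hω, rfl, p, hp, hpA⟩ := hTmem w hw
    exact ⟨ω, hω, rfl, p, hp, hc _ hpA⟩
  have h1 : (T.image (code K L)).card ≤ (T.image (code k l)).card *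
      (M ^ (min k L - l) * D.card ^ (L - k) * (columns D).card ^ (K - max k L)) := by
    -- Each coarse code is represented by the word of a point of `A`, because `hM` controls the
    -- columns of such words only.
    have hrep : ∀ t : Fin K → Option (Fin m) × Option (Fin n), ∃ w : Fin K → Fin m × Fin n,
        t ∈ T.image (code k l) → w ∈ T ∧ code k l w = t := by
      intro t
      by_cases ht : t ∈ T.image (code k l)
      · obtain ⟨w, hw, h⟩ := Finset.mem_image.1 ht
        exact ⟨w, fun _ => ⟨hw, h⟩⟩
      · exact ⟨fun _ => (⟨0, by omega⟩, ⟨0, by omega⟩), fun h => (ht h).elim⟩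
    choose w₀ hw₀ using hrep
    have hsub : T.image (code K L) ⊆
        (T.image (code k l)).biUnion fun t => subcodes D k l L (w₀ t) := by
      intro s hs
      obtain ⟨w, hw, rfl⟩ := Finset.mem_image.1 hs
      have ht := Finset.mem_image_of_mem (code k l) hw
      refine Finset.mem_biUnion.2 ⟨code k l w, ht, Finset.mem_image.2 ⟨w, ?_, rfl⟩⟩
      exact Finset.mem_filter.2 ⟨(Finset.mem_filter.1 hw).1, (hw₀ _ ht).2.symm⟩
    refine (Finset.card_le_card hsub).trans (Finset.card_biUnion_le_card_mul _ _ _ fun t ht => ?_)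
    have hwT := (hw₀ t ht).1
    refine card_subcodes_le hlk hlL hk hL (Finset.mem_filter.1 hwT).1 fun j hj => ?_
    obtain ⟨ω, hω, hωw, p, hp, hpA⟩ := hTmem _ hwT
    rw [← hωw]
    exact hM ω hω p hp hpA j hj
  have h2 : coverNum r A ≤ (T.image (code K L)).card := by
    have hrep : ∀ t : Fin K → Option (Fin m) × Option (Fin n), ∃ y : Plane,
        t ∈ T.image (code K L) → ∃ ω : ℕ → Fin m × Fin n, (∀ j, ω j ∈ D) ∧
          code K L (fun j : Fin K => ω j) = t ∧ ∃ p ∈ F, cellMap ω K p = y := by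
      intro t
      by_cases ht : t ∈ T.image (code K L)
      · obtain ⟨w, hw, h⟩ := Finset.mem_image.1 ht
        obtain ⟨ω, hω, rfl, p, hp, -⟩ := hTmem w hw
        exact ⟨cellMap ω K p, fun _ => ⟨ω, hω, h, p, hp, rfl⟩⟩
      · exact ⟨0, fun h => (ht h).elim⟩
    choose y hy using hrep
    -- A fine cell has diameter at most `r / 8 + r / 8 < r / 2`, so a ball about any of its points
    -- contains it.
    refine coverNum_le_card _ (fun t => Metric.ball (y t) (r / 2)) (fun _ _ => Metric.isOpen_ball)
      (fun t _ x hx z hz => ?_) fun x hx => ?_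
    · have h1 := Metric.mem_ball.1 hx
      have h2 := Metric.mem_ball'.1 hz
      exact (dist_triangle _ _ _).trans (by linarith)
    · obtain ⟨ω, hω, p, hp, rfl⟩ := hF.exists_address hD (hA hx) K
      have hw : (fun j : Fin K => ω j) ∈ T :=
        Finset.mem_filter.2 ⟨restrict_mem_words hω K, ω, hω, rfl, p, hp, hx⟩
      have ht := Finset.mem_image_of_mem (code K L) hw
      refine ⟨_, ht, Metric.mem_ball.2 ?_⟩
      obtain ⟨ω', hω', hcode, p', hp', hy'⟩ := hy _ ht
      rw [← hy']
      exact (hF.dist_cellMap_le hm hn le_rfl hL hω hω' hcode.symm hp hp').trans_lt (by linarith)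
  calc (coverNum r A : ℝ) ≤ ((T.image (code k l)).card : ℝ) *
      ((M ^ (min k L - l) * D.card ^ (L - k) * (columns D).card ^ (K - max k L) : ℕ) : ℝ) := by
        exact_mod_cast h2.trans h1
    _ ≤ _ := mul_le_mul_of_nonneg_right h0 (Nat.cast_nonneg _)

/-- Placing one fixed `p ∈ F` in every refined cell gives points of `A` with distinct codes. By
`card_codes_near_le`, a covering set of diameter `r` contains boundedly many of them. -/
theorem IsCarpet.le_coverNum (hm : 1 < m) (hn : 1 < n) (hD : D.Nonempty) (hF : IsCarpet m n D F)
    {k l K L M : ℕ} (hlk : l ≤ k) (hlL : l ≤ L) (hk : k ≤ K) (hL : L ≤ K) {r : ℝ} (hr : 0 < r)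
    {A : Set Plane} (hA : A ⊆ F) {ω₀ : ℕ → Fin m × Fin n} (hω₀ : ∀ j, ω₀ j ∈ D)
    (hωA : ∀ ω : ℕ → Fin m × Fin n, (∀ j, ω j ∈ D) →
      code k l (fun j : Fin K => ω j) = code k l (fun j : Fin K => ω₀ j) →
      ∀ p ∈ F, cellMap ω K p ∈ A)
    (hM : ∀ j < k, M ≤ columnCount D (ω₀ j).1) :
    ((M ^ (min k L - l) * D.card ^ (L - k) * (columns D).card ^ (K - max k L) : ℕ) : ℝ) ≤
      coverNum r A * ((2 * r * m ^ K + 2) * (2 * r * n ^ L + 2)) := by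
  classical
  obtain ⟨p, hp⟩ := hF.1
  obtain ⟨U, -, hdiam, hcov⟩ := exists_cover hr hF.2.1 hA
  set w₀ : Fin K → Fin m × Fin n := fun j => ω₀ j
  have h0 := le_card_subcodes hlk hlL hk hL (restrict_mem_words hω₀ K)
    (M := M) fun j hj => hM j hj
  have hrep : ∀ s : Fin K → Option (Fin m) × Option (Fin n), ∃ ω : ℕ → Fin m × Fin n,
      s ∈ subcodes D k l L w₀ → (∀ j, ω j ∈ D) ∧ code K L (fun j : Fin K => ω j) = s ∧
        cellMap ω K p ∈ A := by
    intro s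
    by_cases hs : s ∈ subcodes D k l L w₀
    · obtain ⟨w, hw, rfl⟩ := Finset.mem_image.1 hs
      obtain ⟨hw, hcode⟩ := Finset.mem_filter.1 hw
      obtain ⟨ω, hω, rfl⟩ := exists_sequence hD hw
      exact ⟨ω, fun _ => ⟨hω, rfl, hωA ω hω hcode p hp⟩⟩
    · exact ⟨ω₀, fun h => (hs h).elim⟩
  choose ω hω using hrep
  have hsub : subcodes D k l L w₀ ⊆ Finset.univ.biUnion fun i =>
      (subcodes D k l L w₀).filter fun s => cellMap (ω s) K p ∈ U i := by
    intro s hs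
    obtain ⟨i, hi⟩ := Set.mem_iUnion.1 (hcov (hω s hs).2.2)
    exact Finset.mem_biUnion.2 ⟨i, Finset.mem_univ _, Finset.mem_filter.2 ⟨hs, hi⟩⟩
  have hcard : ∀ i, (((subcodes D k l L w₀).filter fun s => cellMap (ω s) K p ∈ U i).card : ℝ) ≤
      (2 * r * m ^ K + 2) * (2 * r * n ^ L + 2) := by
    intro i
    rcases Finset.eq_empty_or_nonempty
      ((subcodes D k l L w₀).filter fun s => cellMap (ω s) K p ∈ U i) with he | ⟨s₀, hs₀⟩
    · rw [he]; simp only [Finset.card_empty, Nat.cast_zero]; positivity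
    · refine hF.card_codes_near_le hm hn le_rfl hL (cellMap (ω s₀) K p) hr.le _ fun s hs => ?_
      obtain ⟨hs, hsU⟩ := Finset.mem_filter.1 hs
      exact ⟨ω s, (hω s hs).1, (hω s hs).2.1, p, hp,
        hdiam i _ hsU _ (Finset.mem_filter.1 hs₀).2⟩
  calc ((M ^ (min k L - l) * D.card ^ (L - k) * (columns D).card ^ (K - max k L) : ℕ) : ℝ)
      ≤ ((subcodes D k l L w₀).card : ℝ) := by exact_mod_cast h0
    _ ≤ ((∑ i, ((subcodes D k l L w₀).filter fun s => cellMap (ω s) K p ∈ U i).card : ℕ) : ℝ) := by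
        exact_mod_cast (Finset.card_le_card hsub).trans Finset.card_biUnion_le
    _ ≤ ∑ _i : Fin (coverNum r A), ((2 * r * m ^ K + 2) * (2 * r * n ^ L + 2) : ℝ) := by
        push_cast
        exact Finset.sum_le_sum fun i _ => hcard i
    _ = _ := by simp

/-! ### Neighbours of a point with constant address -/

theorem digitIndex_const_zero {b : ℕ} (a : Fin b) (ha : (a : ℕ) = 0) (k : ℕ) :
    digitIndex (fun _ => a) k = 0 := by
  induction k with
  | zero => rfl
  | succ k ih => simp [digitIndex, ih, ha]

theorem digitIndex_const_last {b : ℕ} (a : Fin b) (ha : (a : ℕ) + 1 = b) (k : ℕ) :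
    digitIndex (fun _ => a) k + 1 = b ^ k := by
  induction k with
  | zero => rfl
  | succ k ih =>
    rw [pow_succ', ← ih, digitIndex, add_assoc, ha, mul_add, mul_one]

/-- Near a point whose address is constant, all addresses start with the same columns. -/
theorem IsCarpet.column_eq_of_near (hm : 1 < m) (hn : 1 < n) (hF : IsCarpet m n D F) {k K : ℕ}
    (hk : k < K) {d : Fin m × Fin n} (hd : d ∈ D) {ω : ℕ → Fin m × Fin n} (hω : ∀ j, ω j ∈ D)
    {p q : Plane} (hp : p ∈ F) (hq : q ∈ F)
    (h : m ^ (k + 1) * dist (cellMap ω K q) (cellMap (fun _ => d) K p) < 1) :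
    ∀ j < k, (ω j).1 = d.1 := by
  obtain ⟨h1, h2⟩ := hF.column_bounds hm hn hω hk.le hq
  obtain ⟨h3, h4⟩ := hF.column_bounds hm hn (ω := fun _ => d) (fun _ => hd) hk hp
  have hmk : (0 : ℝ) < (m : ℝ) ^ (k + 1) := by positivity
  have h5 := (mul_le_mul_of_nonneg_left
    (abs_coord_sub_le_dist (cellMap ω K q) (cellMap (fun _ => d) K p) 0) hmk.le).trans_lt h
  rw [← abs_of_pos hmk, ← abs_mul, abs_lt, pow_succ'] at h5
  obtain ⟨h5, h6⟩ := h5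
  rw [pow_succ'] at h3 h4
  simp only [digitIndex] at h3 h4
  set A := digitIndex (fun j => (ω j).1) k with hA
  set B := digitIndex (fun _ : ℕ => d.1) k with hB
  have hAlt : A < m ^ k := digitIndex_lt _ k
  push_cast at h3 h4
  set X := cellMap ω K q 0
  set Y := cellMap (fun _ => d) K p 0
  have hm0 : (0 : ℝ) < m := by positivity
  -- If `d.1` is the last digit, `B` is the largest index and nothing lies to the right. Otherwise
  -- the next digit of the constant address keeps the point at least `m ^ (-(k + 1))` away from the
  -- right edge of its column. The left edge is symmetric, with digit `0`.
  have hAB : A ≤ B := by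
    by_cases hlast : (d.1 : ℕ) + 1 = m
    · have := digitIndex_const_last d.1 hlast k
      rw [← hB] at this
      omega
    · have hd2 : ((d.1 : ℕ) : ℝ) + 2 ≤ m := by
        have := d.1.isLt
        exact_mod_cast (by omega : (d.1 : ℕ) + 2 ≤ m)
      have : (m : ℝ) * A < m * (B + 1) := by nlinarith
      have := lt_of_mul_lt_mul_left this hm0.le
      exact Nat.lt_succ_iff.1 (by exact_mod_cast this)
  have hBA : B ≤ A := by
    by_cases hzero : (d.1 : ℕ) = 0
    · rw [hB, digitIndex_const_zero d.1 hzero]; exact Nat.zero_le _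
    · have hd1 : (1 : ℝ) ≤ ((d.1 : ℕ) : ℝ) := by
        exact_mod_cast (by omega : 1 ≤ (d.1 : ℕ))
      have : (m : ℝ) * B < m * (A + 1) := by nlinarith
      have := lt_of_mul_lt_mul_left this hm0.le
      exact Nat.lt_succ_iff.1 (by exact_mod_cast this)
  exact digitIndex_inj (le_antisymm hAB hBA)

end

/-! ### Levels belonging to a scale -/

/-- The number of base `b` digits that determine a number up to an error of order `r`. -/
def level (b : ℕ) (r : ℝ) : ℕ := ⌈Real.logb b (8 / r)⌉₊

theorem one_div_pow_level_le {b : ℕ} (hb : 1 < b) {r : ℝ} (hr : 0 < r) :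
    1 / (b : ℝ) ^ level b r ≤ r / 8 := by
  have hb' : (1 : ℝ) < b := by exact_mod_cast hb
  have h : 8 / r ≤ (b : ℝ) ^ level b r := by
    rw [← Real.rpow_natCast, ← Real.logb_le_iff_le_rpow hb' (by positivity)]
    exact Nat.le_ceil _
  rw [one_div_le (by positivity) (by positivity)]
  simpa using h

theorem level_eq_zero {b : ℕ} (hb : 1 < b) {r : ℝ} (hr : 8 ≤ r) : level b r = 0 := by
  have hb' : (1 : ℝ) < b := by exact_mod_cast hb
  refine Nat.ceil_eq_zero.2 (Real.logb_nonpos hb' (by positivity) ?_)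
  rw [div_le_one (by linarith)]
  exact hr

theorem level_lt {b : ℕ} (hb : 1 < b) {r : ℝ} (hr : 0 < r) (hr8 : r ≤ 8) :
    (level b r : ℝ) < Real.logb b (8 / r) + 1 := by
  have hb' : (1 : ℝ) < b := by exact_mod_cast hb
  refine Nat.ceil_lt_add_one (Real.logb_nonneg hb' ?_)
  rwa [one_le_div hr]

/-- For `r ≥ 8` the level is truncated to `0`, so `r` has to be capped. This costs nothing, since
the carpet has diameter at most `2`. -/
theorem mul_pow_level_le {b : ℕ} (hb : 1 < b) {r : ℝ} (hr : 0 < r) :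
    min r 8 * (b : ℝ) ^ level b r ≤ 8 * b := by
  have hb' : (1 : ℝ) < b := by exact_mod_cast hb
  rcases le_total r 8 with h8 | h8
  · rw [min_eq_left h8]
    have h : (b : ℝ) ^ level b r ≤ 8 / r * b := by
      calc (b : ℝ) ^ level b r = (b : ℝ) ^ (level b r : ℝ) := (Real.rpow_natCast _ _).symm
        _ ≤ (b : ℝ) ^ (Real.logb b (8 / r) + 1) :=
          Real.rpow_le_rpow_of_exponent_le hb'.le (level_lt hb hr h8).le
        _ = 8 / r * b := by
          rw [Real.rpow_add (by linarith), Real.rpow_one,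
            Real.rpow_logb (by linarith) hb'.ne' (by positivity)]
    calc r * (b : ℝ) ^ level b r ≤ r * (8 / r * b) := mul_le_mul_of_nonneg_left h hr.le
      _ = 8 * b := by field_simp
  · rw [min_eq_right h8, level_eq_zero hb h8, pow_zero]
    linarith

theorem level_anti {b : ℕ} (hb : 1 < b) {r R : ℝ} (hr : 0 < r) (h : r ≤ R) :
    level b R ≤ level b r := by
  have hb' : (1 : ℝ) < b := by exact_mod_cast hb
  refine Nat.ceil_mono (Real.logb_le_logb_of_le hb' (by have := hr.trans_le h; positivity) ?_)
  gcongr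

theorem level_le_level (hm : 1 < m) (hmn : m < n) {r : ℝ} (hr : 0 < r) :
    level n r ≤ level m r := by
  have hm' : (1 : ℝ) < m := by exact_mod_cast hm
  have hmn' : (m : ℝ) ≤ n := by exact_mod_cast hmn.le
  rcases le_total r 8 with h8 | h8
  · refine Nat.ceil_mono ?_
    have h1 : 0 ≤ Real.log (8 / r) := Real.log_nonneg (by rwa [one_le_div hr])
    exact div_le_div_of_nonneg_left h1 (Real.log_pos hm') (Real.log_le_log (by linarith) hmn')
  · rw [level_eq_zero (hm.trans hmn) h8]
    exact Nat.zero_le _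

/-- Rounding up costs at most `1`, and the factor `8` costs `log 8 / log b ≤ 3` because `b ≥ 2`. -/
theorem abs_level_sub_le {b : ℕ} (hb : 1 < b) {r : ℝ} (hr : 0 < r) (hr8 : r ≤ 8) :
    |(level b r : ℝ) - -Real.log r / Real.log b| ≤ 4 := by
  have hb' : (2 : ℝ) ≤ b := by exact_mod_cast hb
  have h2 : Real.log 2 ≤ Real.log b := Real.log_le_log (by norm_num) hb'
  have hpos : 0 < Real.log b := (Real.log_pos (by norm_num)).trans_le h2
  have h8 : Real.log 8 = 3 * Real.log 2 := by
    rw [show (8 : ℝ) = 2 ^ 3 by norm_num, Real.log_pow]; norm_num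
  have h3 : Real.log 8 / Real.log b ≤ 3 := by rw [div_le_iff₀ hpos]; linarith
  have h4 : 0 ≤ Real.log 8 / Real.log b := div_nonneg (Real.log_nonneg (by norm_num)) hpos.le
  have h5 : Real.logb b (8 / r) = Real.log 8 / Real.log b + -Real.log r / Real.log b := by
    rw [Real.logb, Real.log_div (by norm_num) hr.ne']; ring
  have h6 := level_lt hb hr hr8
  have h7 : Real.logb b (8 / r) ≤ level b r := Nat.le_ceil _
  rw [abs_le]
  constructor <;> linarith

/-- There is no upper bound on `R`, as the Assouad dimension requires: truncation at `0` can only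
increase the level of `R`. -/
theorem level_sub_level_le {b : ℕ} (hb : 1 < b) {r R : ℝ} (hr : 0 < r) (h : r < R) :
    (level b r : ℝ) - level b R ≤ Real.log (R / r) / Real.log b + 1 := by
  have hb' : (1 : ℝ) < b := by exact_mod_cast hb
  have hR := hr.trans h
  rcases le_total r 8 with h8 | h8
  · have h1 := level_lt hb hr h8
    have h2 : Real.logb b (8 / R) ≤ level b R := Nat.le_ceil _
    have h3 : Real.logb b (8 / r) - Real.logb b (8 / R) = Real.log (R / r) / Real.log b := by
      rw [Real.logb, Real.logb, Real.log_div (by norm_num) hr.ne',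
        Real.log_div (by norm_num) hR.ne', Real.log_div hR.ne' hr.ne']
      ring
    linarith
  · rw [level_eq_zero hb h8, level_eq_zero hb (h8.trans h.le)]
    have h1 : 0 ≤ Real.log (R / r) := Real.log_nonneg ((one_le_div hr).2 h.le)
    have h2 := Real.log_pos hb'
    have : 0 ≤ Real.log (R / r) / Real.log b := by positivity
    simpa using by linarith

/-! ### The growth exponent -/

/-- The logarithm of the number of cells of level `(K, L)` in a cell of level `(k, l)`, where
`μ`, `ν` and `σ` are the logarithms of the number of chosen rectangles in a column, of all
chosen rectangles, and of the nonempty columns. -/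
def growth (μ ν σ k l K L : ℝ) : ℝ :=
  (min k L - l) * μ + (L - min k L) * ν + (K - L - k + min k L) * σ

theorem exp_growth {M N N₀ k l K L : ℕ} (hM : 0 < M) (hN : 0 < N) (hN₀ : 0 < N₀) (hlk : l ≤ k)
    (hlL : l ≤ L) (hk : k ≤ K) (hL : L ≤ K) :
    ((M ^ (min k L - l) * N ^ (L - k) * N₀ ^ (K - max k L) : ℕ) : ℝ) =
      Real.exp (growth (Real.log M) (Real.log N) (Real.log N₀) k l K L) := by
  have hM' : (0 : ℝ) < M := by exact_mod_cast hM
  have hN' : (0 : ℝ) < N := by exact_mod_cast hN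
  have hN₀' : (0 : ℝ) < N₀ := by exact_mod_cast hN₀
  have key : ∀ (a : ℝ), 0 < a → ∀ t : ℕ, a ^ t = Real.exp (t * Real.log a) := by
    intro a ha t
    rw [← Real.log_pow, Real.exp_log (by positivity)]
  push_cast
  rw [key _ hM', key _ hN', key _ hN₀', ← Real.exp_add, ← Real.exp_add]
  congr 1
  unfold growth
  rcases le_total k L with h | h
  · rw [min_eq_left h, max_eq_right h, min_eq_left (Nat.cast_le.2 h)]
    push_cast [hlk, h, hL]
    ring
  · rw [min_eq_right h, max_eq_left h, min_eq_right (Nat.cast_le.2 h), Nat.sub_eq_zero_of_le h]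
    push_cast [hlL, hk]
    ring

/-- The exponent is Lipschitz in the levels: each of its three coefficients moves by at most `4 *
δ`. Rounding of levels and bounded shifts therefore change covering numbers only by a constant
factor. -/
theorem growth_sub_le {μ ν σ δ k l K L k' l' K' L' : ℝ} (hμ : 0 ≤ μ) (hν : 0 ≤ ν) (hσ : 0 ≤ σ)
    (hk : |k - k'| ≤ δ) (hl : |l - l'| ≤ δ) (hK : |K - K'| ≤ δ) (hL : |L - L'| ≤ δ) :
    growth μ ν σ k l K L ≤ growth μ ν σ k' l' K' L' + 4 * δ * (μ + ν + σ) := by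
  have hmin : |min k L - min k' L'| ≤ δ :=
    (abs_min_sub_min_le_max k L k' L').trans (max_le hk hL)
  unfold growth
  rw [abs_le] at *
  have hδ : 0 ≤ δ := by linarith [hk.1, hk.2]
  have h1 : (min k L - l) * μ ≤ (min k' L' - l' + 4 * δ) * μ :=
    mul_le_mul_of_nonneg_right (by linarith [hmin.2, hl.1]) hμ
  have h2 : (L - min k L) * ν ≤ (L' - min k' L' + 4 * δ) * ν :=
    mul_le_mul_of_nonneg_right (by linarith [hmin.1, hL.2]) hν
  have h3 : (K - L - k + min k L) * σ ≤ (K' - L' - k' + min k' L' + 4 * δ) * σ :=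
    mul_le_mul_of_nonneg_right (by linarith [hmin.2, hL.1, hK.2, hk.1]) hσ
  linarith

/-! ### Covering numbers of balls -/

section
variable {D : Finset (Fin m × Fin n)} {F : Set Plane}

theorem mem_columns {d : Fin m × Fin n} (hd : d ∈ D) : d.1 ∈ columns D :=
  Finset.mem_image_of_mem _ hd

theorem card_columns_pos (hD : D.Nonempty) : 0 < (columns D).card :=
  Finset.card_pos.2 (hD.image _)

theorem columnCount_pos {i : Fin m} (hi : i ∈ columns D) : 0 < columnCount D i := by
  obtain ⟨d, hd, rfl⟩ := Finset.mem_image.1 hi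
  exact Finset.card_pos.2 ⟨d, Finset.mem_filter.2 ⟨hd, rfl⟩⟩

theorem columnCount_le_maxCount (hD : D.Nonempty) {i : Fin m} (hi : i ∈ columns D) :
    columnCount D i ≤ maxCount D hD :=
  Finset.le_sup' (columnCount D) hi

theorem minCount_le_columnCount (hD : D.Nonempty) {i : Fin m} (hi : i ∈ columns D) :
    minCount D hD ≤ columnCount D i :=
  Finset.inf'_le (columnCount D) hi

theorem exists_columnCount_eq_maxCount (hD : D.Nonempty) :
    ∃ d ∈ D, columnCount D d.1 = maxCount D hD := by
  obtain ⟨i, hi, h⟩ := Finset.exists_mem_eq_sup' (hD.image Prod.fst) (columnCount D)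
  obtain ⟨d, hd, rfl⟩ := Finset.mem_image.1 hi
  exact ⟨d, hd, h.symm⟩

theorem exists_columnCount_eq_minCount (hD : D.Nonempty) :
    ∃ d ∈ D, columnCount D d.1 = minCount D hD := by
  obtain ⟨i, hi, h⟩ := Finset.exists_mem_eq_inf' (hD.image Prod.fst) (columnCount D)
  obtain ⟨d, hd, rfl⟩ := Finset.mem_image.1 hi
  exact ⟨d, hd, h.symm⟩

theorem maxCount_pos (hD : D.Nonempty) : 0 < maxCount D hD := by
  obtain ⟨d, hd, h⟩ := exists_columnCount_eq_maxCount hD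
  rw [← h]; exact columnCount_pos (mem_columns hd)

theorem minCount_pos (hD : D.Nonempty) : 0 < minCount D hD := by
  obtain ⟨d, hd, h⟩ := exists_columnCount_eq_minCount hD
  rw [← h]; exact columnCount_pos (mem_columns hd)

theorem card_le_card_columns_mul_maxCount (hD : D.Nonempty) :
    D.card ≤ (columns D).card * maxCount D hD := by
  rw [Finset.card_eq_sum_card_image Prod.fst D, ← smul_eq_mul]
  exact Finset.sum_le_card_nsmul _ _ _ fun i hi => columnCount_le_maxCount hD hi

/-- The exponential growth rate of cell counts, in a column with `M` chosen rectangles, from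
scale `R` to scale `r`. -/
def cellGrowth (D : Finset (Fin m × Fin n)) (M : ℕ) (r R : ℝ) : ℝ :=
  growth (Real.log M) (Real.log D.card) (Real.log (columns D).card)
    (level m R) (level n R) (level m r) (level n r)

/-- The constant up to which covering numbers are determined. -/
def ballConst (m n : ℕ) : ℝ := (2 * (8 * m) + 2) * (2 * (8 * n) + 2)

theorem ballConst_pos (m n : ℕ) : 0 < ballConst m n := by
  unfold ballConst; positivity

theorem IsCarpet.dist_le_two (hm : 1 < m) (hn : 1 < n) (hF : IsCarpet m n D F) {x y : Plane}
    (hx : x ∈ F) (hy : y ∈ F) : dist x y ≤ 2 := by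
  obtain ⟨⟨h1, h2⟩, h3, h4⟩ := hF.mem_Icc hm hn hx
  obtain ⟨⟨h5, h6⟩, h7, h8⟩ := hF.mem_Icc hm hn hy
  refine (dist_le_add_abs x y).trans ?_
  have h9 : |x 0 - y 0| ≤ 1 := abs_le.2 ⟨by linarith, by linarith⟩
  have h10 : |x 1 - y 1| ≤ 1 := abs_le.2 ⟨by linarith, by linarith⟩
  linarith

theorem IsCarpet.dist_le_min (hm : 1 < m) (hn : 1 < n) (hF : IsCarpet m n D F) {x y : Plane}
    {R : ℝ} (hx : x ∈ F) (hy : y ∈ Metric.closedBall x R ∩ F) : dist y x ≤ min R 8 :=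
  le_min (Metric.mem_closedBall.1 hy.1) ((hF.dist_le_two hm hn hy.2 hx).trans (by norm_num))

theorem IsCarpet.coverNum_ball_le (hm : 1 < m) (hmn : m < n) (hD : D.Nonempty)
    (hF : IsCarpet m n D F) {r R : ℝ} (hr : 0 < r) (hrR : r < R) {x : Plane} (hx : x ∈ F) :
    (coverNum r (Metric.closedBall x R ∩ F) : ℝ) ≤
      ballConst m n * Real.exp (cellGrowth D (maxCount D hD) r R) := by
  have hn := hm.trans hmn
  have hR := hr.trans hrR
  have h := hF.coverNum_le hm hn hD (level_le_level hm hmn hR) (level_anti hn hr hrR.le)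
    (level_anti hm hr hrR.le) (level_le_level hm hmn hr) (ρ := min R 8) (by positivity) hr
    (one_div_pow_level_le hm hr) (one_div_pow_level_le hn hr) (A := Metric.closedBall x R ∩ F)
    Set.inter_subset_right x (fun y hy => hF.dist_le_min hm hn hx hy)
    (M := maxCount D hD) fun ω hω _ _ _ j _ => columnCount_le_maxCount hD (mem_columns (hω j))
  rw [exp_growth (maxCount_pos hD) hD.card_pos (card_columns_pos hD) (level_le_level hm hmn hR)
    (level_anti hn hr hrR.le) (level_anti hm hr hrR.le) (level_le_level hm hmn hr)] at h
  refine h.trans (mul_le_mul_of_nonneg_right ?_ (Real.exp_nonneg _))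
  have h1 := mul_pow_level_le hm hR
  have h2 := mul_pow_level_le hn hR
  rw [ballConst, mul_assoc, mul_assoc]
  gcongr

/-- The cell of level `R` around the centre has diameter at most `R / 4`, so it lies in the ball.
Any address serves with `M` the minimal count, and a constant one with the count of its column. -/
theorem IsCarpet.exp_le_coverNum_ball (hm : 1 < m) (hmn : m < n) (hD : D.Nonempty)
    (hF : IsCarpet m n D F) {r R : ℝ} (hr : 0 < r) (hrR : r < R) (hr8 : r ≤ 8)
    {ω₀ : ℕ → Fin m × Fin n} (hω₀ : ∀ j, ω₀ j ∈ D) {p : Plane} (hp : p ∈ F) {M : ℕ} (hM0 : 0 < M)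
    (hM : ∀ j, M ≤ columnCount D (ω₀ j).1) :
    Real.exp (cellGrowth D M r R) ≤ ballConst m n *
      coverNum r (Metric.closedBall (cellMap ω₀ (level m r) p) R ∩ F) := by
  have hn := hm.trans hmn
  have hR := hr.trans hrR
  have h := hF.le_coverNum hm hn hD (level_le_level hm hmn hR) (level_anti hn hr hrR.le)
    (level_anti hm hr hrR.le) (level_le_level hm hmn hr) hr
    (A := Metric.closedBall (cellMap ω₀ (level m r) p) R ∩ F) Set.inter_subset_right hω₀
    (fun ω hω hcode q hq => ⟨?_, hF.cellMap_mem hω _ hq⟩) (fun j _ => hM j)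
  · rw [exp_growth hM0 hD.card_pos (card_columns_pos hD) (level_le_level hm hmn hR)
      (level_anti hn hr hrR.le) (level_anti hm hr hrR.le) (level_le_level hm hmn hr)] at h
    refine h.trans ?_
    rw [mul_comm]
    refine mul_le_mul_of_nonneg_right ?_ (Nat.cast_nonneg _)
    have h1 := mul_pow_level_le hm hr
    have h2 := mul_pow_level_le hn hr
    rw [min_eq_left hr8] at h1 h2
    rw [ballConst, mul_assoc, mul_assoc]
    gcongr
  · rw [Metric.mem_closedBall]
    refine (hF.dist_cellMap_le hm hn (level_anti hm hr hrR.le)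
      ((level_anti hn hr hrR.le).trans (level_le_level hm hmn hr)) hω hω₀ hcode hq hp).trans ?_
    have h1 := one_div_pow_level_le hm hR
    have h2 := one_div_pow_level_le hn hR
    linarith

/-- Cells six levels coarser are so wide that every point of the ball shares the column digits of
the centre, hence only the column of `d` is counted. The term with `4 * 6` is the cost of this
coarsening in `growth_sub_le`. -/
theorem IsCarpet.coverNum_ball_const_le (hm : 1 < m) (hmn : m < n) (hD : D.Nonempty)
    (hF : IsCarpet m n D F) {r R : ℝ} (hr : 0 < r) (hrR : r < R) {d : Fin m × Fin n} (hd : d ∈ D)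
    {p : Plane} (hp : p ∈ F) :
    (coverNum r (Metric.closedBall (cellMap (fun _ => d) (level m r) p) R ∩ F) : ℝ) ≤
      ballConst m n * Real.exp (cellGrowth D (columnCount D d.1) r R + 4 * 6 *
        (Real.log (columnCount D d.1) + Real.log D.card + Real.log (columns D).card)) := by
  have hn := hm.trans hmn
  have hR := hr.trans hrR
  have hm' : (2 : ℝ) ≤ m := by exact_mod_cast hm
  have hx := hF.cellMap_mem (ω := fun _ => d) (fun _ => hd) (level m r) hp
  have hlk : level n R - 6 ≤ level m R - 6 := Nat.sub_le_sub_right (level_le_level hm hmn hR) 6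
  have hlL : level n R - 6 ≤ level n r := (Nat.sub_le _ _).trans (level_anti hn hr hrR.le)
  have hkK : level m R - 6 ≤ level m r := (Nat.sub_le _ _).trans (level_anti hm hr hrR.le)
  have h := hF.coverNum_le hm hn hD hlk hlL hkK (level_le_level hm hmn hr) (ρ := min R 8)
    (by positivity) hr (one_div_pow_level_le hm hr) (one_div_pow_level_le hn hr)
    (A := Metric.closedBall (cellMap (fun _ => d) (level m r) p) R ∩ F)
    Set.inter_subset_right _ (fun y hy => hF.dist_le_min hm hn hx hy)
    (M := columnCount D d.1) fun ω hω q hq hqA j hj => ?_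
  · rw [exp_growth (columnCount_pos (mem_columns hd)) hD.card_pos (card_columns_pos hD) hlk hlL hkK
      (level_le_level hm hmn hr)] at h
    refine h.trans (mul_le_mul ?_ ?_ (Real.exp_nonneg _) (ballConst_pos m n).le)
    · have h1 : min R 8 * (m : ℝ) ^ (level m R - 6) ≤ 8 * m :=
        (mul_le_mul_of_nonneg_left (pow_le_pow_right₀ (by linarith) (Nat.sub_le _ _))
          (by positivity)).trans (mul_pow_level_le hm hR)
      have h2 : min R 8 * (n : ℝ) ^ (level n R - 6) ≤ 8 * n :=
        (mul_le_mul_of_nonneg_left (pow_le_pow_right₀ (by exact_mod_cast hn.le) (Nat.sub_le _ _))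
          (by positivity)).trans (mul_pow_level_le hn hR)
      rw [ballConst, mul_assoc, mul_assoc]
      gcongr
    · rw [Real.exp_le_exp]
      have key : ∀ t : ℕ, |((t - 6 : ℕ) : ℝ) - t| ≤ 6 := by
        intro t
        rw [abs_sub_comm, abs_of_nonneg (sub_nonneg.2 (Nat.cast_le.2 (Nat.sub_le t 6)))]
        have : t ≤ t - 6 + 6 := by omega
        have : (t : ℝ) ≤ (t - 6 : ℕ) + 6 := by exact_mod_cast this
        linarith
      exact growth_sub_le (Real.log_natCast_nonneg _) (Real.log_natCast_nonneg _)
        (Real.log_natCast_nonneg _) (key _) (key _) (by simp) (by simp)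
  -- From `R * m ^ level m R ≤ 8 * m` it follows that `R * m ^ (level m R - 5) ≤ 8 / m ^ 4 ≤ 1 / 2`.
  -- Six is thus enough for `column_eq_of_near`, which itself uses one further level.
  · have hk6 : level m R - 6 + 6 = level m R := by omega
    have hR8 : R ≤ 8 := by
      by_contra hR8
      rw [level_eq_zero hm (not_le.1 hR8).le] at hj
      omega
    have h1 := mul_pow_level_le hm hR
    rw [min_eq_left hR8, ← hk6, pow_add] at h1
    have h2 := Metric.mem_closedBall.1 hqA.1
    have hmk : (0 : ℝ) < (m : ℝ) ^ (level m R - 6) := by positivity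
    have h3 : (2 : ℝ) ^ 4 ≤ (m : ℝ) ^ 4 := pow_le_pow_left₀ (by norm_num) hm' 4
    have h4 : (R * (m : ℝ) ^ (level m R - 6) * m) * (m : ℝ) ^ 4 ≤ 8 := by
      refine le_of_mul_le_mul_right (a := (m : ℝ)) ?_ (by positivity)
      calc _ = R * ((m : ℝ) ^ (level m R - 6) * (m : ℝ) ^ 6) := by ring
        _ ≤ _ := h1
    have h5 : 0 ≤ R * (m : ℝ) ^ (level m R - 6) * m := by positivity
    have h6 : (m : ℝ) ^ (level m R - 6 + 1) *
        dist (cellMap ω (level m r) q) (cellMap (fun _ => d) (level m r) p) < 1 := by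
      have h7 := mul_le_mul_of_nonneg_left h2 (pow_nonneg (by linarith : (0 : ℝ) ≤ m)
        (level m R - 6 + 1))
      refine h7.trans_lt ?_
      rw [pow_succ]
      nlinarith
    have h7 : level m R - 6 < level m r := by
      have := level_anti hm hr hrR.le
      omega
    rw [hF.column_eq_of_near hm hn h7 hd hω hp hq h6 j hj]

end

/-! ### From two-sided estimates to dimensions -/

theorem le_of_rpow_le_mul_rpow {s α C : ℝ} (h : ∀ t : ℝ, 1 < t → t ^ s ≤ C * t ^ α) : s ≤ α := by
  by_contra! hlt
  obtain ⟨t, ht1, htC⟩ := ((Filter.eventually_gt_atTop 1).and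
    ((tendsto_rpow_atTop (sub_pos.2 hlt)).eventually_gt_atTop C)).exists
  have ht0 : (0 : ℝ) < t := by linarith
  have h1 := h t ht1
  rw [Real.rpow_sub ht0, lt_div_iff₀ (Real.rpow_pos_of_pos ht0 _)] at htC
  linarith

theorem exists_scale {θ : ℝ} (hθ : θ < 1) {t : ℝ} (ht : 1 < t) :
    ∃ r : ℝ, 0 < r ∧ r < 1 ∧ r ^ θ / r = t := by
  have ht0 : (0 : ℝ) < t := by linarith
  have h1 : 0 < 1 - θ := by linarith
  refine ⟨t ^ (-(1 / (1 - θ))), Real.rpow_pos_of_pos ht0 _,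
    Real.rpow_lt_one_of_one_lt_of_neg ht (by simpa using h1), ?_⟩
  rw [← Real.rpow_mul ht0.le, ← Real.rpow_sub ht0,
    show -(1 / (1 - θ)) * θ - -(1 / (1 - θ)) = 1 by field_simp; ring, Real.rpow_one]

theorem le_of_scale_bound {θ : ℝ} (hθ : θ < 1) {s α C : ℝ}
    (h : ∀ r : ℝ, 0 < r → r < 1 → (r ^ θ / r) ^ s ≤ C * (r ^ θ / r) ^ α) : s ≤ α :=
  le_of_rpow_le_mul_rpow fun t ht => by
    obtain ⟨r, h0, h1, rfl⟩ := exists_scale hθ ht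
    exact h r h0 h1

theorem lt_rpow_of_lt_one {θ r : ℝ} (hθ : θ < 1) (hr : 0 < r) (hr1 : r < 1) : r < r ^ θ := by
  simpa using Real.rpow_lt_rpow_of_exponent_gt hr hr1 hθ

/-- The exponent `s` is itself admissible, hence a least element. Any other admissible exponent is
compared with it at the extremal points, where `r ^ θ / r` runs through all of `(1, ∞)`. -/
theorem assouadSpectrum_eq {F : Set Plane} {θ s C : ℝ} (hθ : θ < 1) (hC : 0 < C)
    (h₁ : ∀ r : ℝ, 0 < r → r < 1 → ∀ x ∈ F,
      (coverNum r (Metric.closedBall x (r ^ θ) ∩ F) : ℝ) ≤ C * (r ^ θ / r) ^ s)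
    (h₂ : ∀ r : ℝ, 0 < r → r < 1 → ∃ x ∈ F,
      (r ^ θ / r) ^ s ≤ C * coverNum r (Metric.closedBall x (r ^ θ) ∩ F)) :
    assouadSpectrum θ F = s := by
  refine IsLeast.csInf_eq ⟨⟨C, hC, h₁⟩, ?_⟩
  rintro α ⟨C', hC', hα⟩
  refine le_of_scale_bound (C := C * C') hθ fun r hr hr1 => ?_
  obtain ⟨x, hx, h⟩ := h₂ r hr hr1
  rw [mul_assoc]
  exact h.trans (mul_le_mul_of_nonneg_left (hα r hr hr1 x hx) hC.le)

theorem lowerSpectrum_eq {F : Set Plane} {θ s C : ℝ} (hθ : θ < 1) (hC : 0 < C)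
    (h₁ : ∀ r : ℝ, 0 < r → r < 1 → ∀ x ∈ F,
      (r ^ θ / r) ^ s ≤ C * coverNum r (Metric.closedBall x (r ^ θ) ∩ F))
    (h₂ : ∀ r : ℝ, 0 < r → r < 1 → ∃ x ∈ F,
      (coverNum r (Metric.closedBall x (r ^ θ) ∩ F) : ℝ) ≤ C * (r ^ θ / r) ^ s) :
    lowerSpectrum θ F = s := by
  refine IsGreatest.csSup_eq ⟨⟨C⁻¹, inv_pos.2 hC, fun r hr hr1 x hx => ?_⟩, ?_⟩
  · rw [inv_mul_le_iff₀ hC]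
    exact h₁ r hr hr1 x hx
  · rintro α ⟨C', hC', hα⟩
    refine le_of_scale_bound (C := C'⁻¹ * C) hθ fun r hr hr1 => ?_
    obtain ⟨x, hx, h⟩ := h₂ r hr hr1
    rw [mul_assoc, le_inv_mul_iff₀ hC']
    exact (hα r hr hr1 x hx).trans h

/-- For the lower bound it suffices to test the pairs of scales `R = r ^ θ` for a single `θ`. -/
theorem assouadDim_eq {F : Set Plane} {θ s C C' : ℝ} (hθ : θ < 1) (hC : 0 < C) (hC' : 0 < C')
    (h₁ : ∀ r R : ℝ, 0 < r → r < R → ∀ x ∈ F,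
      (coverNum r (Metric.closedBall x R ∩ F) : ℝ) ≤ C * (R / r) ^ s)
    (h₂ : ∀ r : ℝ, 0 < r → r < 1 → ∃ x ∈ F,
      (r ^ θ / r) ^ s ≤ C' * coverNum r (Metric.closedBall x (r ^ θ) ∩ F)) :
    assouadDim F = s := by
  refine IsLeast.csInf_eq ⟨⟨C, hC, h₁⟩, ?_⟩
  rintro α ⟨C'', _, hα⟩
  refine le_of_scale_bound (C := C' * C'') hθ fun r hr hr1 => ?_
  obtain ⟨x, hx, h⟩ := h₂ r hr hr1
  rw [mul_assoc]
  exact h.trans (mul_le_mul_of_nonneg_left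
    (hα r (r ^ θ) hr (lt_rpow_of_lt_one hθ hr hr1) x hx) hC'.le)

theorem hasBoxDim_of_bounds {F : Set Plane} {d C : ℝ} (hC : 0 < C)
    (h₁ : ∀ r : ℝ, 0 < r → r < 1 → (coverNum r F : ℝ) ≤ C * Real.exp (-Real.log r * d))
    (h₂ : ∀ r : ℝ, 0 < r → r < 1 → Real.exp (-Real.log r * d) ≤ C * coverNum r F) :
    HasBoxDim F d := by
  have hlog : Filter.Tendsto (fun r : ℝ => -Real.log r) (nhdsWithin 0 (Set.Ioi 0))
      Filter.atTop :=
    Filter.tendsto_neg_atBot_atTop.comp Real.tendsto_log_nhdsGT_zero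
  have hlim : ∀ c : ℝ, Filter.Tendsto (fun r : ℝ => d + c / (-Real.log r))
      (nhdsWithin 0 (Set.Ioi 0)) (nhds d) := fun c => by
    simpa using (hlog.const_div_atTop c).const_add d
  have hev : ∀ᶠ r : ℝ in nhdsWithin 0 (Set.Ioi 0), 0 < r ∧ r < 1 :=
    Ioo_mem_nhdsGT one_pos
  have h : Filter.Tendsto (fun r : ℝ => Real.log (coverNum r F) / (-Real.log r))
      (nhdsWithin 0 (Set.Ioi 0)) (nhds d) := by
    refine tendsto_of_tendsto_of_tendsto_of_le_of_le' (hlim (-Real.log C)) (hlim (Real.log C))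
      ?_ ?_
    · filter_upwards [hev] with r ⟨hr, hr1⟩
      have hu : 0 < -Real.log r := neg_pos.2 (Real.log_neg hr hr1)
      have hpos : (0 : ℝ) < coverNum r F :=
        pos_of_mul_pos_right ((Real.exp_pos _).trans_le (h₂ r hr hr1)) hC.le
      have h3 := Real.log_le_log (Real.exp_pos _) (h₂ r hr hr1)
      rw [Real.log_exp, Real.log_mul hC.ne' hpos.ne'] at h3
      rw [le_div_iff₀ hu, add_mul, div_mul_cancel₀ _ hu.ne']
      linarith
    · filter_upwards [hev] with r ⟨hr, hr1⟩
      have hu : 0 < -Real.log r := neg_pos.2 (Real.log_neg hr hr1)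
      have hpos : (0 : ℝ) < coverNum r F :=
        pos_of_mul_pos_right ((Real.exp_pos _).trans_le (h₂ r hr hr1)) hC.le
      have h3 := Real.log_le_log hpos (h₁ r hr hr1)
      rw [Real.log_mul hC.ne' (Real.exp_pos _).ne', Real.log_exp] at h3
      rw [div_le_iff₀ hu, add_mul, div_mul_cancel₀ _ hu.ne']
      linarith
  exact ⟨h.liminf_eq, h.limsup_eq⟩

/-! ### Exponents at logarithmic scales and the dimension formulas -/

section
variable {D : Finset (Fin m × Fin n)} {F : Set Plane}

/-- The exponential growth rate of cell counts, in a column with `M` chosen rectangles, from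
scale `exp (-v)` to scale `exp (-u)`. -/
def scaleGrowth (D : Finset (Fin m × Fin n)) (M : ℕ) (u v : ℝ) : ℝ :=
  growth (Real.log M) (Real.log D.card) (Real.log (columns D).card)
    (v / Real.log m) (v / Real.log n) (u / Real.log m) (u / Real.log n)

theorem cellGrowth_le_scaleGrowth (hm : 1 < m) (hn : 1 < n) (D : Finset (Fin m × Fin n)) (M : ℕ)
    {r R : ℝ} (hr : 0 < r) (hr8 : r ≤ 8) (hR : 0 < R) (hR8 : R ≤ 8) :
    cellGrowth D M r R ≤ scaleGrowth D M (-Real.log r) (-Real.log R) +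
      4 * 4 * (Real.log M + Real.log D.card + Real.log (columns D).card) :=
  growth_sub_le (Real.log_natCast_nonneg _) (Real.log_natCast_nonneg _)
    (Real.log_natCast_nonneg _) (abs_level_sub_le hm hR hR8) (abs_level_sub_le hn hR hR8)
    (abs_level_sub_le hm hr hr8) (abs_level_sub_le hn hr hr8)

theorem scaleGrowth_le_cellGrowth (hm : 1 < m) (hn : 1 < n) (D : Finset (Fin m × Fin n)) (M : ℕ)
    {r R : ℝ} (hr : 0 < r) (hr8 : r ≤ 8) (hR : 0 < R) (hR8 : R ≤ 8) :
    scaleGrowth D M (-Real.log r) (-Real.log R) ≤ cellGrowth D M r R +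
      4 * 4 * (Real.log M + Real.log D.card + Real.log (columns D).card) := by
  refine growth_sub_le (Real.log_natCast_nonneg _) (Real.log_natCast_nonneg _)
    (Real.log_natCast_nonneg _) ?_ ?_ ?_ ?_ <;> rw [abs_sub_comm]
  · exact abs_level_sub_le hm hR hR8
  · exact abs_level_sub_le hn hR hR8
  · exact abs_level_sub_le hm hr hr8
  · exact abs_level_sub_le hn hr hr8

theorem IsCarpet.exists_ball_bounds (hm : 1 < m) (hmn : m < n) (hD : D.Nonempty)
    (hF : IsCarpet m n D F) : ∃ C : ℝ, 0 < C ∧ ∀ r R : ℝ, 0 < r → r < R → R ≤ 8 →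
      (∀ x ∈ F, (coverNum r (Metric.closedBall x R ∩ F) : ℝ) ≤
        C * Real.exp (scaleGrowth D (maxCount D hD) (-Real.log r) (-Real.log R))) ∧
      (∀ x ∈ F, Real.exp (scaleGrowth D (minCount D hD) (-Real.log r) (-Real.log R)) ≤
        C * coverNum r (Metric.closedBall x R ∩ F)) ∧
      (∃ x ∈ F, Real.exp (scaleGrowth D (maxCount D hD) (-Real.log r) (-Real.log R)) ≤
        C * coverNum r (Metric.closedBall x R ∩ F)) ∧
      (∃ x ∈ F, (coverNum r (Metric.closedBall x R ∩ F) : ℝ) ≤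
        C * Real.exp (scaleGrowth D (minCount D hD) (-Real.log r) (-Real.log R))) := by
  have hn := hm.trans hmn
  obtain ⟨d₁, hd₁, hmax⟩ := exists_columnCount_eq_maxCount hD
  obtain ⟨d₂, hd₂, hmin⟩ := exists_columnCount_eq_minCount hD
  obtain ⟨p, hp⟩ := hF.1
  have hle : Real.log (minCount D hD) ≤ Real.log (maxCount D hD) := by
    refine Real.log_le_log (by exact_mod_cast minCount_pos hD) ?_
    rw [← hmax]
    exact_mod_cast minCount_le_columnCount hD (mem_columns hd₁)
  have h0 := Real.log_natCast_nonneg D.card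
  have h1 := Real.log_natCast_nonneg (columns D).card
  have h2 := Real.log_natCast_nonneg (minCount D hD)
  have hB := ballConst_pos m n
  -- `40 = 4 * 6 + 4 * 4`: the coarsening near a constant address plus the replacement of integer
  -- levels by real ones.
  set c := 40 * (Real.log (maxCount D hD) + Real.log D.card + Real.log (columns D).card) with hc
  have lower : ∀ {a b t y : ℝ}, b ≤ a + t → t ≤ c → Real.exp a ≤ ballConst m n * y →
      Real.exp b ≤ ballConst m n * Real.exp c * y := by
    intro a b t y h3 h4 h5
    calc Real.exp b ≤ Real.exp (c + a) := Real.exp_le_exp.2 (by linarith)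
      _ = Real.exp c * Real.exp a := Real.exp_add _ _
      _ ≤ Real.exp c * (ballConst m n * y) := mul_le_mul_of_nonneg_left h5 (Real.exp_nonneg _)
      _ = _ := by ring
  have upper : ∀ {a b t y : ℝ}, a ≤ b + t → t ≤ c → y ≤ ballConst m n * Real.exp a →
      y ≤ ballConst m n * Real.exp c * Real.exp b := by
    intro a b t y h3 h4 h5
    rw [mul_assoc, ← Real.exp_add]
    exact h5.trans (mul_le_mul_of_nonneg_left (Real.exp_le_exp.2 (by linarith)) hB.le)
  refine ⟨ballConst m n * Real.exp c, by positivity, fun r R hr hrR hR8 => ⟨fun x hx => ?_,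
    fun x hx => ?_, ⟨cellMap (fun _ => d₁) (level m r) p, hF.cellMap_mem (fun _ => hd₁) _ hp, ?_⟩,
    ⟨cellMap (fun _ => d₂) (level m r) p, hF.cellMap_mem (fun _ => hd₂) _ hp, ?_⟩⟩⟩
  · exact upper (cellGrowth_le_scaleGrowth hm hn D _ hr (by linarith) (by linarith) hR8)
      (by linarith) (hF.coverNum_ball_le hm hmn hD hr hrR hx)
  · obtain ⟨ω, hω, q, hq, rfl⟩ := hF.exists_address hD hx (level m r)
    exact lower (scaleGrowth_le_cellGrowth hm hn D _ hr (by linarith) (by linarith) hR8)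
      (by linarith) (hF.exp_le_coverNum_ball hm hmn hD hr hrR (by linarith) hω hq (minCount_pos hD)
        fun j => minCount_le_columnCount hD (mem_columns (hω j)))
  · exact lower (scaleGrowth_le_cellGrowth hm hn D _ hr (by linarith) (by linarith) hR8)
      (by linarith) (hF.exp_le_coverNum_ball hm hmn hD hr hrR (by linarith) (fun _ => hd₁) hp
        (maxCount_pos hD) fun j => hmax.ge)
  · have h3 := hF.coverNum_ball_const_le hm hmn hD hr hrR hd₂ hp
    rw [hmin] at h3
    refine upper (t := 40 * (Real.log (minCount D hD) + Real.log D.card +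
      Real.log (columns D).card)) ?_ (by linarith) h3
    have := cellGrowth_le_scaleGrowth hm hn D (minCount D hD) hr (by linarith) (hr.trans hrR) hR8
    linarith

theorem IsCarpet.hasBoxDim (hm : 1 < m) (hmn : m < n) (hD : D.Nonempty) (hF : IsCarpet m n D F) :
    HasBoxDim F (Real.log (columns D).card / Real.log m +
      Real.log (D.card / (columns D).card) / Real.log n) := by
  have hn := hm.trans hmn
  obtain ⟨p, hp⟩ := hF.1
  have hN : (0 : ℝ) < D.card := by exact_mod_cast hD.card_pos
  have hN₀ : (0 : ℝ) < (columns D).card := by exact_mod_cast card_columns_pos hD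
  have hball : ∀ x ∈ F, Metric.closedBall x 8 ∩ F = F := fun x hx =>
    Set.inter_eq_right.2 fun y hy => (hF.dist_le_two hm hn hy hx).trans (by norm_num)
  have h0 := Real.log_natCast_nonneg D.card
  have h1 := Real.log_natCast_nonneg (columns D).card
  -- A ball of radius `8` is the whole carpet and has levels `0`; no column is prescribed, so `M`
  -- drops out.
  have hcell : ∀ (M : ℕ) (r : ℝ), cellGrowth D M r 8 =
      growth 0 (Real.log D.card) (Real.log (columns D).card) 0 0 (level m r) (level n r) := by
    intro M r
    simp [cellGrowth, growth, level_eq_zero hm le_rfl, level_eq_zero hn le_rfl]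
  have hreal : ∀ r : ℝ, 0 < r → r < 1 →
      growth 0 (Real.log D.card) (Real.log (columns D).card) 0 0
        (-Real.log r / Real.log m) (-Real.log r / Real.log n) = -Real.log r *
      (Real.log (columns D).card / Real.log m +
        Real.log (D.card / (columns D).card) / Real.log n) := by
    intro r hr hr1
    have h2 : 0 ≤ -Real.log r / Real.log n :=
      div_nonneg (neg_nonneg.2 (Real.log_nonpos hr.le hr1.le)) (Real.log_natCast_nonneg n)
    rw [growth, min_eq_left h2, Real.log_div hN.ne' hN₀.ne']
    ring
  set c := 4 * 4 * (0 + Real.log D.card + Real.log (columns D).card) with hc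
  have hB := ballConst_pos m n
  refine hasBoxDim_of_bounds (C := ballConst m n * Real.exp c) (by positivity)
    (fun r hr hr1 => ?_) fun r hr hr1 => ?_
  · have h2 := hF.coverNum_ball_le hm hmn hD hr (hr1.trans (by norm_num) : r < 8) hp
    rw [hball p hp, hcell] at h2
    rw [← hreal r hr hr1, mul_assoc, ← Real.exp_add]
    refine h2.trans (mul_le_mul_of_nonneg_left (Real.exp_le_exp.2 ?_) hB.le)
    rw [add_comm c]
    exact growth_sub_le le_rfl h0 h1 (by simp) (by simp) (abs_level_sub_le hm hr (by linarith))
      (abs_level_sub_le hn hr (by linarith))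
  · obtain ⟨d, hd⟩ := hD
    have h2 := hF.exp_le_coverNum_ball hm hmn ⟨d, hd⟩ hr (hr1.trans (by norm_num) : r < 8)
      (by linarith) (fun _ => hd) hp (columnCount_pos (mem_columns hd)) fun _ => le_rfl
    rw [hball _ (hF.cellMap_mem (fun _ => hd) _ hp), hcell] at h2
    have h3 : growth 0 (Real.log D.card) (Real.log (columns D).card) 0 0
        (-Real.log r / Real.log m) (-Real.log r / Real.log n) ≤
        growth 0 (Real.log D.card) (Real.log (columns D).card) 0 0 (level m r) (level n r) + c := by
      refine growth_sub_le le_rfl h0 h1 (by simp) (by simp) ?_ ?_ <;> rw [abs_sub_comm]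
      · exact abs_level_sub_le hm hr (by linarith)
      · exact abs_level_sub_le hn hr (by linarith)
    rw [← hreal r hr hr1]
    calc _ ≤ _ := Real.exp_le_exp.2 h3
      _ = Real.exp c * Real.exp _ := by rw [add_comm, Real.exp_add]
      _ ≤ Real.exp c * (ballConst m n * coverNum r F) :=
        mul_le_mul_of_nonneg_left h2 (Real.exp_nonneg _)
      _ = _ := by ring

theorem exp_mul_one_sub_mul {r θ s : ℝ} (hr : 0 < r) :
    Real.exp (s * ((1 - θ) * -Real.log r)) = (r ^ θ / r) ^ s := by
  have h : r ^ θ / r = Real.exp ((1 - θ) * -Real.log r) := by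
    rw [Real.rpow_def_of_pos hr, ← Real.exp_log hr, ← Real.exp_sub, Real.exp_log hr]
    congr 1; ring
  rw [h, ← Real.exp_mul, mul_comm]

theorem IsCarpet.spectra_eq (hm : 1 < m) (hmn : m < n) (hD : D.Nonempty) (hF : IsCarpet m n D F)
    {θ smax smin : ℝ} (hθ0 : 0 < θ) (hθ : θ < 1)
    (hmax : ∀ u : ℝ, 0 < u →
      scaleGrowth D (maxCount D hD) u (θ * u) = smax * ((1 - θ) * u))
    (hmin : ∀ u : ℝ, 0 < u →
      scaleGrowth D (minCount D hD) u (θ * u) = smin * ((1 - θ) * u)) :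
    assouadSpectrum θ F = smax ∧ lowerSpectrum θ F = smin := by
  obtain ⟨C, hC, h⟩ := hF.exists_ball_bounds hm hmn hD
  have key : ∀ r : ℝ, 0 < r → r < 1 →
      r < r ^ θ ∧ r ^ θ ≤ 8 ∧
      Real.exp (scaleGrowth D (maxCount D hD) (-Real.log r) (-Real.log (r ^ θ))) =
        (r ^ θ / r) ^ smax ∧
      Real.exp (scaleGrowth D (minCount D hD) (-Real.log r) (-Real.log (r ^ θ))) =
        (r ^ θ / r) ^ smin := by
    intro r hr hr1
    have hu : 0 < -Real.log r := neg_pos.2 (Real.log_neg hr hr1)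
    refine ⟨lt_rpow_of_lt_one hθ hr hr1,
      (Real.rpow_le_one hr.le hr1.le hθ0.le).trans (by norm_num), ?_, ?_⟩
    · rw [Real.log_rpow hr, ← mul_neg, hmax _ hu, exp_mul_one_sub_mul hr]
    · rw [Real.log_rpow hr, ← mul_neg, hmin _ hu, exp_mul_one_sub_mul hr]
  constructor
  · refine assouadSpectrum_eq hθ hC (fun r hr hr1 => ?_) fun r hr hr1 => ?_
    · obtain ⟨k1, k2, k3, -⟩ := key r hr hr1
      exact k3 ▸ (h r _ hr k1 k2).1
    · obtain ⟨k1, k2, k3, -⟩ := key r hr hr1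
      exact k3 ▸ (h r _ hr k1 k2).2.2.1
  · refine lowerSpectrum_eq hθ hC (fun r hr hr1 => ?_) fun r hr hr1 => ?_
    · obtain ⟨k1, k2, -, k3⟩ := key r hr hr1
      exact k3 ▸ (h r _ hr k1 k2).2.1
    · obtain ⟨k1, k2, -, k3⟩ := key r hr hr1
      exact k3 ▸ (h r _ hr k1 k2).2.2.2

/-- Below the transition, the column level of `R = r ^ θ` does not exceed the row level of `r`, so
positions with a completely free digit can occur and `N` enters. -/
theorem scaleGrowth_of_le (hm : 1 < m) (hmn : m < n) (hD : D.Nonempty) {M : ℕ} (hM : 0 < M)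
    {θ u : ℝ} (hu : 0 < u) (hθ : θ < 1) (h : θ ≤ Real.log m / Real.log n) :
    scaleGrowth D M u (θ * u) =
      ((Real.log (columns D).card / Real.log m + Real.log (D.card / (columns D).card) / Real.log n
        - θ * (Real.log (D.card / M) / Real.log m + Real.log M / Real.log n)) / (1 - θ)) *
      ((1 - θ) * u) := by
  have hlm : 0 < Real.log m := Real.log_pos (by exact_mod_cast hm)
  have hln : 0 < Real.log n := Real.log_pos (by exact_mod_cast hm.trans hmn)
  have hN : (0 : ℝ) < D.card := by exact_mod_cast hD.card_pos
  have hN₀ : (0 : ℝ) < (columns D).card := by exact_mod_cast card_columns_pos hD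
  have hM' : (0 : ℝ) < M := by exact_mod_cast hM
  have hle : θ * u / Real.log m ≤ u / Real.log n := by
    rw [le_div_iff₀ hln] at h
    rw [div_le_div_iff₀ hlm hln]
    nlinarith
  have h1 : 1 - θ ≠ 0 := by linarith
  rw [scaleGrowth, growth, min_eq_left hle, Real.log_div hN.ne' hN₀.ne',
    Real.log_div hN.ne' hM'.ne', ← mul_assoc, div_mul_cancel₀ _ h1]
  ring

/-- Above the transition, every position whose row is refined already has its column, so `N`
disappears and the slope no longer depends on `θ`. -/
theorem scaleGrowth_of_ge (hm : 1 < m) (hmn : m < n) (M : ℕ)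
    {θ u : ℝ} (hu : 0 < u) (h : Real.log m / Real.log n ≤ θ) :
    scaleGrowth D M u (θ * u) =
      (Real.log (columns D).card / Real.log m + Real.log M / Real.log n) * ((1 - θ) * u) := by
  have hlm : 0 < Real.log m := Real.log_pos (by exact_mod_cast hm)
  have hln : 0 < Real.log n := Real.log_pos (by exact_mod_cast hm.trans hmn)
  have hle : u / Real.log n ≤ θ * u / Real.log m := by
    rw [div_le_iff₀ hln] at h
    rw [div_le_div_iff₀ hln hlm]
    nlinarith
  rw [scaleGrowth, growth, min_eq_right hle]
  ring

theorem IsCarpet.assouadDim_eq (hm : 1 < m) (hmn : m < n) (hD : D.Nonempty)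
    (hF : IsCarpet m n D F) : assouadDim F =
      Real.log (columns D).card / Real.log m + Real.log (maxCount D hD) / Real.log n := by
  have hn := hm.trans hmn
  have hlm : 0 < Real.log m := Real.log_pos (by exact_mod_cast hm)
  have hln : 0 < Real.log n := Real.log_pos (by exact_mod_cast hn)
  have hlmn : Real.log m < Real.log n := Real.log_lt_log (by positivity) (by exact_mod_cast hmn)
  have hθ0 : 0 < Real.log m / Real.log n := by positivity
  have hθ : Real.log m / Real.log n < 1 := (div_lt_one hln).2 hlmn
  have hN : (0 : ℝ) < D.card := by exact_mod_cast hD.card_pos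
  have hN₀ : (0 : ℝ) < (columns D).card := by exact_mod_cast card_columns_pos hD
  have hM : (0 : ℝ) < maxCount D hD := by exact_mod_cast maxCount_pos hD
  have hνle : Real.log D.card ≤ Real.log (columns D).card + Real.log (maxCount D hD) := by
    rw [← Real.log_mul hN₀.ne' hM.ne']
    exact Real.log_le_log hN (by exact_mod_cast card_le_card_columns_mul_maxCount hD)
  have h0 := Real.log_natCast_nonneg (maxCount D hD)
  have h1 := Real.log_natCast_nonneg (columns D).card
  obtain ⟨C, hC, h⟩ := hF.exists_ball_bounds hm hmn hD
  have hB := ballConst_pos m n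
  -- The exponential factor absorbs the `+ 1` in `level_sub_level_le`. The upper bound uses
  -- `coverNum_ball_le` directly, since `exists_ball_bounds` is restricted to `R ≤ 8`.
  refine Carpet.assouadDim_eq (C := ballConst m n *
    Real.exp (Real.log (columns D).card + Real.log (maxCount D hD))) hθ (by positivity) hC
    (fun r R hr hrR x hx => ?_) fun r hr hr1 => ?_
  · have hRr : 0 < R / r := div_pos (hr.trans hrR) hr
    refine (hF.coverNum_ball_le hm hmn hD hr hrR hx).trans ?_
    rw [Real.rpow_def_of_pos hRr, mul_assoc, ← Real.exp_add]
    refine mul_le_mul_of_nonneg_left (Real.exp_le_exp.2 ?_) hB.le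
    have h2 := level_sub_level_le hm hr hrR
    have h3 := level_sub_level_le hn hr hrR
    have h4 : (0 : ℝ) ≤ level n r - min (level m R : ℝ) (level n r) :=
      sub_nonneg.2 (min_le_right _ _)
    have h5 := mul_le_mul_of_nonneg_left hνle h4
    have h6 := mul_le_mul_of_nonneg_right h2 h1
    have h7 := mul_le_mul_of_nonneg_right h3 h0
    rw [cellGrowth, growth]
    -- Each free digit is charged as a column times at most `N_max` rows, so the position of `min`
    -- cancels and the row and column levels separate.
    calc _ ≤ (level n r - level n R : ℝ) * Real.log (maxCount D hD) +
          (level m r - level m R : ℝ) * Real.log (columns D).card := by linarith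
      _ ≤ _ := add_le_add h7 h6
      _ = _ := by ring
  · have hu : 0 < -Real.log r := neg_pos.2 (Real.log_neg hr hr1)
    obtain ⟨x, hx, hxr⟩ := (h r _ hr (lt_rpow_of_lt_one hθ hr hr1)
      ((Real.rpow_le_one hr.le hr1.le hθ0.le).trans (by norm_num))).2.2.1
    refine ⟨x, hx, ?_⟩
    rwa [Real.log_rpow hr, ← mul_neg, scaleGrowth_of_ge hm hmn _ hu le_rfl,
      exp_mul_one_sub_mul hr] at hxr

end

end Carpet

end

theorem theorem8p3p3 (m n : ℕ) (hm : 1 < m) (hmn : m < n)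
    (D : Finset (Fin m × Fin n)) (hD : D.Nonempty)
    (F : Set Carpet.Plane) (hF : Carpet.IsCarpet m n D F)
    (N N₀ Nmax Nmin : ℝ) (hN : N = (D.card : ℝ))
    (hN₀ : N₀ = ((Carpet.columns D).card : ℝ))
    (hNmax : Nmax = (Carpet.maxCount D hD : ℝ))
    (hNmin : Nmin = (Carpet.minCount D hD : ℝ)) :
    (∃ dimB : ℝ, Carpet.HasBoxDim F dimB ∧
      dimB = Real.log N₀ / Real.log m + Real.log (N / N₀) / Real.log n ∧
      ∀ θ : ℝ, 0 < θ → θ ≤ Real.log m / Real.log n →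
        Carpet.assouadSpectrum θ F =
          (dimB - θ * (Real.log (N / Nmax) / Real.log m + Real.log Nmax / Real.log n))
            / (1 - θ) ∧
        Carpet.lowerSpectrum θ F =
          (dimB - θ * (Real.log (N / Nmin) / Real.log m + Real.log Nmin / Real.log n))
            / (1 - θ)) ∧
    (∀ θ : ℝ, Real.log m / Real.log n ≤ θ → θ < 1 →
      Carpet.assouadSpectrum θ F = Real.log N₀ / Real.log m + Real.log Nmax / Real.log n ∧
      Carpet.lowerSpectrum θ F = Real.log N₀ / Real.log m + Real.log Nmin / Real.log n) ∧
    Carpet.assouadDim F = Real.log N₀ / Real.log m + Real.log Nmax / Real.log n := by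
  subst hN hN₀ hNmax hNmin
  have hlm : 0 < Real.log m := Real.log_pos (by exact_mod_cast hm)
  have hln : 0 < Real.log n := Real.log_pos (by exact_mod_cast hm.trans hmn)
  have hlmn : Real.log m < Real.log n := Real.log_lt_log (by positivity) (by exact_mod_cast hmn)
  refine ⟨⟨_, hF.hasBoxDim hm hmn hD, rfl, fun θ hθ0 hθ => ?_⟩, fun θ hθ hθ1 => ?_,
    hF.assouadDim_eq hm hmn hD⟩
  · have hθ1 : θ < 1 := hθ.trans_lt ((div_lt_one hln).2 hlmn)
    exact hF.spectra_eq hm hmn hD hθ0 hθ1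
      (fun u hu => Carpet.scaleGrowth_of_le hm hmn hD (Carpet.maxCount_pos hD) hu hθ1 hθ)
      (fun u hu => Carpet.scaleGrowth_of_le hm hmn hD (Carpet.minCount_pos hD) hu hθ1 hθ)
  · exact hF.spectra_eq hm hmn hD ((by positivity : 0 < Real.log m / Real.log n).trans_le hθ) hθ1
      (fun u hu => Carpet.scaleGrowth_of_ge hm hmn _ hu hθ)
      (fun u hu => Carpet.scaleGrowth_of_ge hm hmn _ hu hθ)
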